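/- Let $n\ge 2$, $\lambda\in\mathbb R$, and let $\Sigma_n$ be the complex spinor module of $\mathbb R^n$: a Hermitian vector space of complex dimension $2^{[n/2]}$ with a Clifford multiplication by vectors satisfying $v\cdot v\cdot\varphi=-|v|^2\varphi$ and $\langle v\cdot\varphi,\psi\rangle=-\langle\varphi,v\cdot\psi\rangle$. Spinors on $\mathbb R^n$ are $\Sigma_n$-valued functions, and the Euclidean Dirac operator is $D\psi=\sum_{i=1}^n E_i\cdot\partial_i\psi$, where $(E_i)$ is the standard basis. A *Green's function* for $D-\lambda$ is a map $G:\{(x,y)\in\mathbb R^n\times\mathbb R^n: x\ne y\}\to\mathrm{End}_{\mathbb C}(\Sigma_n)$ which is smooth, locally integrable on $\mathbb R^n\times\mathbb R^n$, and satisfies $$\lim_{\varepsilon\to0}\int_{\mathbb R^n\setminus B_\varepsilon(p)}\big\langle (D-\lambda)\psi(x),\,G(x,p)\varphi\big\rangle\,dx=\langle\psi(p),\varphi\rangle$$ for all $p\in\mathbb R^n$, all $\varphi\in\Sigma_n$ and all smooth compactly supported $\psi:\mathbb R^n\to\Sigma_n$. Let $J_m$, $Y_m$ be the Bessel functions of the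 first and second kind, $c$ Euler's constant, $\Gamma$ the Gamma function, $\omega_{n-1}$ the volume of the unit sphere $S^{n-1}$, and $m:=\frac{n-2}{2}$. Define $f_\lambda:\mathbb R^n\setminus\{0\}\to\mathbb R$ as follows. For $\lambda\ne0$ and $n=2$, $$f_\lambda(x):=-\tfrac14Y_0(|\lambda x|)+\frac{\ln|\lambda|-\ln 2+c}{2\pi}J_0(|\lambda x|);$$ for $\lambda\ne0$ and odd $n\ge3$, $$f_\lambda(x):=-\frac{\pi|\lambda|^m}{2^m\Gamma(m)(n-2)\omega_{n-1}}|x|^{-m}Y_m(|\lambda x|);$$ for $\lambda\ne0$ and even $n\ge4$, $$f_\lambda(x):=-\frac{\pi|\lambda|^m}{2^m\Gamma(m)(n-2)\omega_{n-1}}|x|^{-m}\Big(Y_m(|\lambda x|)-\frac{2(\ln|\lambda|-\ln2)}{\pi}J_m(|\lambda x|)\Big);$$ and $$f_0(x):=-\frac1{2\pi}\ln|x|\quad(n=2),\qquad f_0(x):=\frac{1}{(n-2)\omega_{n-1}|x|^{n-2}}\quad(n\ge3).$$ Then there is a Green's function $G_\lambda$ for $D-\lambda$ such that, for every constant spinor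 $\gamma\in\Sigma_n$ and all $x\ne y$, $$G_\lambda(x,y)\gamma=\big((D+\lambda)(f_\lambda\gamma)\big)(x-y);$$ in particular $G_\lambda(x,0)\gamma=(D+\lambda)(f_\lambda\gamma)(x)$ for all $x\neq0$. -/

import Mathlib

open MeasureTheory Filter Topology
open scoped ContDiff Kronecker

noncomputable section

namespace EuclideanDirac

/-! ### Bessel functions -/

/-- The Bessel function of the first kind of real order `ν`, for `z > 0`:
`J_ν(z) = (z/2)^ν ∑ₖ (-z²/4)^k / (k! Γ(ν+k+1))`.
The terms with a pole of `Γ` vanish, since `Real.Gamma` is `0` there. -/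
def besselJ (ν z : ℝ) : ℝ :=
  (z / 2) ^ ν * ∑' k : ℕ, (-(z ^ 2 / 4)) ^ k / ((k.factorial : ℝ) * Real.Gamma (ν + k + 1))

/-- The digamma function at positive integers, `ψ(j+1) = H_j - γ`, where `γ` is Euler's constant. -/
def digammaSucc (j : ℕ) : ℝ := (harmonic j : ℝ) - Real.eulerMascheroniConstant

/-- The Bessel function of the second kind of order `m = 0, 1, 2, …`, for `z > 0`:
`Y_m(z) = -(z/2)^{-m}/π ∑_{k<m} (m-k-1)!/k! (z²/4)^k + (2/π) ln(z/2) J_m(z)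
  - (z/2)^m/π ∑ₖ (ψ(k+1) + ψ(m+k+1)) (-z²/4)^k / (k! (m+k)!)`. -/
def besselYNat (m : ℕ) (z : ℝ) : ℝ :=
  -(((z / 2) ^ m)⁻¹ / Real.pi) *
      ∑ k ∈ Finset.range m, ((m - k - 1).factorial : ℝ) / (k.factorial : ℝ) * (z ^ 2 / 4) ^ k
    + 2 / Real.pi * Real.log (z / 2) * besselJ m z
    - (z / 2) ^ m / Real.pi *
      ∑' k : ℕ, (digammaSucc k + digammaSucc (m + k)) * (-(z ^ 2 / 4)) ^ k /
        ((k.factorial : ℝ) * ((m + k).factorial : ℝ))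

open Classical in
/-- The Bessel function of the second kind of real order `ν`, for `z > 0`:
`Y_ν = (J_ν cos(νπ) - J_{-ν}) / sin(νπ)` for non-integral `ν`, the explicit expansion for
`ν = 0, 1, 2, …`, and `Y_{-m} = (-1)^m Y_m` for negative integers. -/
def besselY (ν z : ℝ) : ℝ :=
  if ∃ j : ℤ, ν = j then
    (if 0 ≤ ν then besselYNat ⌊ν⌋₊ z else (-1) ^ ⌊-ν⌋₊ * besselYNat ⌊-ν⌋₊ z)
  else
    (besselJ ν z * Real.cos (ν * Real.pi) - besselJ (-ν) z) / Real.sin (ν * Real.pi)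

/-! ### Spinors on Euclidean space -/

/-- Euclidean space `ℝⁿ`. -/
abbrev E (n : ℕ) : Type := EuclideanSpace ℝ (Fin n)

/-- The structure of the complex spinor module `Σ_n` of `ℝⁿ` on a Hermitian vector space `S`:
`S` has complex dimension `2^[n/2]`, and vectors act by a Clifford multiplication
`v · v · φ = -|v|² φ` which is skew-Hermitian. (The dimension makes it irreducible, so for even `n`
there is exactly one such module up to isomorphism and for odd `n` there are two, which agree on the
spin group.) See `standardSpinorModule` for the explicit model. -/
structure SpinorModule (n : ℕ) (S : Type*) [NormedAddCommGroup S] [InnerProductSpace ℂ S] where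
  /-- Clifford multiplication `v ↦ (φ ↦ v · φ)`. -/
  clifford : E n →ₗ[ℝ] (S →L[ℂ] S)
  clifford_sq : ∀ (v : E n) (φ : S), clifford v (clifford v φ) = -((‖v‖ ^ 2 : ℝ) • φ)
  clifford_skew : ∀ (v : E n) (φ ψ : S),
    inner ℂ (clifford v φ) ψ = -inner ℂ φ (clifford v ψ)
  finrank_eq : Module.finrank ℂ S = 2 ^ (n / 2)

section Dirac

variable {n : ℕ} {S : Type*} [NormedAddCommGroup S] [InnerProductSpace ℂ S]

/-- The Euclidean Dirac operator `Dψ = ∑ᵢ Eᵢ · ∇_{Eᵢ} ψ`. The spinor bundle of `ℝⁿ` is trivialized by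
constant spinors, so its sections are functions with values in `S` and `∇` is the derivative. -/
def dirac (σ : SpinorModule n S) (ψ : E n → S) (x : E n) : S :=
  ∑ i : Fin n, σ.clifford (EuclideanSpace.single i 1)
    (fderiv ℝ ψ x (EuclideanSpace.single i 1))

/-- `G` is a Green's function for `D - lam` on `ℝⁿ`: a section of `Hom(Σ_y, Σ_x)`, smooth off the
diagonal (its values on the diagonal are irrelevant) and locally integrable on `ℝⁿ × ℝⁿ`, with
`lim_{ε → 0} ∫_{ℝⁿ ∖ B_ε(p)} ⟨(D - lam)ψ, G(·,p)φ⟩ = ⟨ψ(p), φ⟩` for all `p`, all `φ` and all smooth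
compactly supported spinors `ψ`. -/
structure IsGreensFunction (σ : SpinorModule n S) (lam : ℝ) (G : E n → E n → (S →L[ℂ] S)) :
    Prop where
  smooth : ContDiffOn ℝ ∞ (fun q : E n × E n => G q.1 q.2) {q | q.1 ≠ q.2}
  locallyIntegrable : LocallyIntegrable (fun q : E n × E n => G q.1 q.2) volume
  tendsto_integral : ∀ (p : E n) (φ : S) (ψ : E n → S), ContDiff ℝ ∞ ψ → HasCompactSupport ψ →
    Tendsto
      (fun ε : ℝ => ∫ x in (Metric.ball p ε)ᶜ, inner ℂ (dirac σ ψ x - lam • ψ x) (G x p φ))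
      (𝓝[>] 0) (𝓝 (inner ℂ (ψ p) φ))

end Dirac

/-- The volume `ω_{n-1}` of the unit sphere `S^{n-1}` in `ℝⁿ`. -/
def sphereVol (n : ℕ) : ℝ := ((volume : Measure (E n)).toSphere Set.univ).toReal

/-- The radial function `f_lam` on `ℝⁿ ∖ {0}`, `n ≥ 2`, with `m = (n-2)/2`. -/
def radialFun (n : ℕ) (lam : ℝ) (x : E n) : ℝ :=
  let m : ℝ := ((n : ℝ) - 2) / 2
  if lam = 0 then
    if n = 2 then -(1 / (2 * Real.pi)) * Real.log ‖x‖
    else 1 / (((n : ℝ) - 2) * sphereVol n * ‖x‖ ^ (n - 2))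
  else if n = 2 then
    -(1 / 4) * besselY 0 (|lam| * ‖x‖)
      + (Real.log |lam| - Real.log 2 + Real.eulerMascheroniConstant) / (2 * Real.pi)
        * besselJ 0 (|lam| * ‖x‖)
  else if Odd n then
    -(Real.pi * |lam| ^ m / (2 ^ m * Real.Gamma m * ((n : ℝ) - 2) * sphereVol n))
      * ‖x‖ ^ (-m) * besselY m (|lam| * ‖x‖)
  else
    -(Real.pi * |lam| ^ m / (2 ^ m * Real.Gamma m * ((n : ℝ) - 2) * sphereVol n))
      * ‖x‖ ^ (-m)
      * (besselY m (|lam| * ‖x‖)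
          - 2 * (Real.log |lam| - Real.log 2) / Real.pi * besselJ m (|lam| * ‖x‖))

/-! ### The explicit model of the spinor module -/

/-- Index set of a basis of `Σ_n`; it has `2^[n/2]` elements. -/
def SpinIndex : ℕ → Type
  | 0 => Unit
  | 1 => Unit
  | n + 2 => SpinIndex n × Fin 2

instance spinIndexFintype : (n : ℕ) → Fintype (SpinIndex n)
  | 0 => inferInstanceAs (Fintype Unit)
  | 1 => inferInstanceAs (Fintype Unit)
  | n + 2 =>
    haveI := spinIndexFintype n
    inferInstanceAs (Fintype (SpinIndex n × Fin 2))

instance spinIndexDecidableEq : (n : ℕ) → DecidableEq (SpinIndex n)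
  | 0 => inferInstanceAs (DecidableEq Unit)
  | 1 => inferInstanceAs (DecidableEq Unit)
  | n + 2 =>
    haveI := spinIndexDecidableEq n
    inferInstanceAs (DecidableEq (SpinIndex n × Fin 2))

theorem card_spinIndex : (n : ℕ) → Fintype.card (SpinIndex n) = 2 ^ (n / 2)
  | 0 => rfl
  | 1 => rfl
  | n + 2 => by
    have h := card_spinIndex n
    have h2 : Fintype.card (SpinIndex (n + 2)) = Fintype.card (SpinIndex n × Fin 2) := rfl
    rw [h2, Fintype.card_prod, h, Fintype.card_fin, Nat.add_div_right n (by norm_num), pow_succ]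

/-- From Clifford matrices for `ℝⁿ` to Clifford matrices for `ℝⁿ⁺²`. -/
def gammaStep {n : ℕ} {ι : Type} [DecidableEq ι] (g : Fin n → Matrix ι ι ℂ) :
    Fin (n + 2) → Matrix (ι × Fin 2) (ι × Fin 2) ℂ :=
  Fin.cons ((1 : Matrix ι ι ℂ) ⊗ₖ !![0, Complex.I; Complex.I, 0])
    (Fin.cons ((1 : Matrix ι ι ℂ) ⊗ₖ !![0, 1; -1, 0])
      (fun i => g i ⊗ₖ !![1, 0; 0, -1]))

/-- The matrices of Clifford multiplication by the standard basis vectors of `ℝⁿ`. -/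
def gammaMat : (n : ℕ) → Fin n → Matrix (SpinIndex n) (SpinIndex n) ℂ
  | 0 => fun i => i.elim0
  | 1 => fun _ => Complex.I • (1 : Matrix (SpinIndex 1) (SpinIndex 1) ℂ)
  | n + 2 => gammaStep (gammaMat n)

theorem gammaMat_anticomm : (n : ℕ) → ∀ i j : Fin n,
    gammaMat n i * gammaMat n j + gammaMat n j * gammaMat n i
      = (if i = j then (-2 : ℂ) else 0) • (1 : Matrix (SpinIndex n) (SpinIndex n) ℂ)
  | 0 => fun i => i.elim0
  | 1 => fun i j => by
    have hij : i = j := Subsingleton.elim _ _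
    subst hij
    have h : (Complex.I • (1 : Matrix (SpinIndex 1) (SpinIndex 1) ℂ)) * (Complex.I • 1)
        + (Complex.I • 1) * (Complex.I • 1) = (-2 : ℂ) • 1 := by
      rw [smul_mul_smul_comm, ← add_smul, Complex.I_mul_I, one_mul]
      norm_num
    simpa [gammaMat] using h
  | n + 2 => by
    have ih := gammaMat_anticomm n
    have key : ∀ i j : Fin (n + 2), gammaStep (gammaMat n) i * gammaStep (gammaMat n) j
        + gammaStep (gammaMat n) j * gammaStep (gammaMat n) i
        = (if i = j then (-2 : ℂ) else 0) • (1 : Matrix (SpinIndex n × Fin 2) _ ℂ) := by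
      have h1 : (1 : Matrix (SpinIndex n × Fin 2) (SpinIndex n × Fin 2) ℂ)
          = (1 : Matrix (SpinIndex n) (SpinIndex n) ℂ) ⊗ₖ (1 : Matrix (Fin 2) (Fin 2) ℂ) :=
        Matrix.one_kronecker_one.symm
      intro i j
      rw [h1]
      refine Fin.cases ?_ (fun i => Fin.cases ?_ (fun i => ?_) i) i <;>
        refine Fin.cases ?_ (fun j => Fin.cases ?_ (fun j => ?_) j) j
      all_goals
        simp only [gammaStep, Fin.cons_zero, Fin.cons_succ, ← Matrix.mul_kronecker_mul,
          Matrix.one_mul, Matrix.mul_one, Fin.succ_inj]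
      · rw [← Matrix.kronecker_add, if_pos trivial, ← Matrix.kronecker_smul]
        congr 1
        ext a b
        fin_cases a <;> fin_cases b <;> simp <;> norm_num
      · rw [← Matrix.kronecker_add, if_neg (by simp), zero_smul, ← Matrix.kronecker_zero]
        congr 1
        ext a b
        fin_cases a <;> fin_cases b <;> simp
      · rw [← Matrix.kronecker_add, if_neg (Fin.succ_ne_zero _).symm, zero_smul,
          ← Matrix.kronecker_zero]
        congr 1
        ext a b
        fin_cases a <;> fin_cases b <;> simp
      · rw [← Matrix.kronecker_add, if_neg (by simp), zero_smul, ← Matrix.kronecker_zero]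
        congr 1
        ext a b
        fin_cases a <;> fin_cases b <;> simp
      · rw [← Matrix.kronecker_add, if_pos trivial, ← Matrix.kronecker_smul]
        congr 1
        ext a b
        fin_cases a <;> fin_cases b <;> simp <;> norm_num
      · rw [← Matrix.kronecker_add, if_neg (Fin.succ_ne_zero _).symm, zero_smul,
          ← Matrix.kronecker_zero]
        congr 1
        ext a b
        fin_cases a <;> fin_cases b <;> simp
      · rw [← Matrix.kronecker_add, if_neg (Fin.succ_ne_zero _), zero_smul,
          ← Matrix.kronecker_zero]
        congr 1
        ext a b
        fin_cases a <;> fin_cases b <;> simp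
      · rw [← Matrix.kronecker_add, if_neg (Fin.succ_ne_zero _), zero_smul,
          ← Matrix.kronecker_zero]
        congr 1
        ext a b
        fin_cases a <;> fin_cases b <;> simp
      · have h2 : (!![1, 0; 0, -1] * !![1, 0; 0, -1] : Matrix (Fin 2) (Fin 2) ℂ) = 1 := by
          ext a b
          fin_cases a <;> fin_cases b <;> simp
        rw [h2, ← Matrix.add_kronecker, ih, Matrix.smul_kronecker]
    exact key

theorem gammaMat_star : (n : ℕ) → ∀ i : Fin n, star (gammaMat n i) = -gammaMat n i
  | 0 => fun i => i.elim0
  | 1 => fun i => by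
    simp [gammaMat]
  | n + 2 => by
    have ih := gammaMat_star n
    have key : ∀ i : Fin (n + 2),
        star (gammaStep (gammaMat n) i) = -gammaStep (gammaMat n) i := by
      intro i
      refine Fin.cases ?_ (fun i => Fin.cases ?_ (fun i => ?_) i) i
      all_goals
        simp only [gammaStep, Fin.cons_zero, Fin.cons_succ, Matrix.star_eq_conjTranspose,
          Matrix.conjTranspose_kronecker]
      · ext ⟨a, a'⟩ ⟨b, b'⟩
        fin_cases a' <;> fin_cases b' <;> simp [Matrix.conjTranspose]
      · ext ⟨a, a'⟩ ⟨b, b'⟩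
        fin_cases a' <;> fin_cases b' <;> simp [Matrix.conjTranspose]
      · rw [← Matrix.star_eq_conjTranspose, ih]
        ext ⟨a, a'⟩ ⟨b, b'⟩
        fin_cases a' <;> fin_cases b' <;> simp [Matrix.conjTranspose]
    exact key

/-- The matrix of Clifford multiplication by a vector. -/
def cliffordMat (n : ℕ) (v : E n) : Matrix (SpinIndex n) (SpinIndex n) ℂ :=
  ∑ i, (v i : ℂ) • gammaMat n i

theorem cliffordMat_sq (n : ℕ) (v : E n) :
    cliffordMat n v * cliffordMat n v = (-(‖v‖ ^ 2 : ℝ) : ℂ) • 1 := by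
  have h : cliffordMat n v * cliffordMat n v + cliffordMat n v * cliffordMat n v
      = ∑ i, ∑ j, ((v i : ℂ) * (v j : ℂ)) •
        (gammaMat n i * gammaMat n j + gammaMat n j * gammaMat n i) := by
    simp only [smul_add, Finset.sum_add_distrib]
    congr 1
    · simp only [cliffordMat, Finset.sum_mul, Finset.mul_sum, smul_mul_smul_comm]
      exact Finset.sum_comm
    · simp only [cliffordMat, Finset.sum_mul, Finset.mul_sum, smul_mul_smul_comm]
      refine Finset.sum_congr rfl fun i _ => Finset.sum_congr rfl fun j _ => ?_
      rw [mul_comm (v i : ℂ)]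
  have h2 : ∑ i, ∑ j, ((v i : ℂ) * (v j : ℂ)) •
        (gammaMat n i * gammaMat n j + gammaMat n j * gammaMat n i)
        = (2 * (-(‖v‖ ^ 2 : ℝ) : ℂ)) • (1 : Matrix (SpinIndex n) (SpinIndex n) ℂ) := by
    simp only [gammaMat_anticomm, ite_smul, zero_smul, smul_ite, smul_zero,
      Finset.sum_ite_eq, Finset.mem_univ, if_true, smul_smul]
    rw [← Finset.sum_smul, EuclideanSpace.real_norm_sq_eq]
    congr 1
    push_cast
    rw [← Finset.sum_neg_distrib, Finset.mul_sum]
    exact Finset.sum_congr rfl fun i _ => by ring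
  rw [h2, ← two_smul ℂ, mul_smul] at h
  exact smul_right_injective _ (two_ne_zero (α := ℂ)) h

theorem cliffordMat_star (n : ℕ) (v : E n) : star (cliffordMat n v) = -cliffordMat n v := by
  simp [cliffordMat, star_sum, star_smul, gammaMat_star]

/-- The explicit model of `Σ_n`. -/
def standardSpinorModule (n : ℕ) : SpinorModule n (EuclideanSpace ℂ (SpinIndex n)) where
  clifford :=
    { toFun := fun v => Matrix.toEuclideanCLM (𝕜 := ℂ) (cliffordMat n v)
      map_add' := fun v w => by
        rw [← map_add]
        congr 1
        simp [cliffordMat, add_smul, Finset.sum_add_distrib]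
      map_smul' := fun r v => by
        have h : cliffordMat n (r • v) = (r : ℂ) • cliffordMat n v := by
          simp [cliffordMat, mul_smul, Finset.smul_sum]
        rw [h, map_smul]
        rfl }
  clifford_sq := fun v φ => by
    change (Matrix.toEuclideanCLM (𝕜 := ℂ) (cliffordMat n v) *
      Matrix.toEuclideanCLM (𝕜 := ℂ) (cliffordMat n v)) φ = _
    rw [← map_mul, cliffordMat_sq, map_smul, map_one]
    change (-(‖v‖ ^ 2 : ℝ) : ℂ) • φ = _
    rw [neg_smul, Complex.coe_smul]
  clifford_skew := fun v φ ψ => by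
    change inner ℂ (Matrix.toEuclideanCLM (𝕜 := ℂ) (cliffordMat n v) φ) ψ
      = -inner ℂ φ (Matrix.toEuclideanCLM (𝕜 := ℂ) (cliffordMat n v) ψ)
    rw [← ContinuousLinearMap.adjoint_inner_right, ← ContinuousLinearMap.star_eq_adjoint,
      ← map_star, cliffordMat_star, map_neg, _root_.neg_apply, inner_neg_right]
  finrank_eq := by rw [finrank_euclideanSpace, card_spinIndex]

end EuclideanDirac

end

noncomputable section

open MeasureTheory Filter Topology
open scoped ContDiff Kronecker

namespace EuclideanDirac

/-! ### Clifford multiplication and the Dirac operator -/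

section Dirac

variable {n : ℕ} {S : Type*} [NormedAddCommGroup S] [InnerProductSpace ℂ S]

/-! Since `D² = -Δ`, one has `(D - λ)(D + λ) = -Δ - λ²`. If `f` is a radial fundamental solution of
`-Δ - λ²`, then `K γ = (D + λ)(f γ)` is a fundamental solution of `D - λ`, and its translates form a
Green's function. The argument uses only three properties of `f(x) = F(|x|²)`, collected in
`IsRadialProfile`: the ordinary differential equation for `F` on `s > 0`, the flux normalisation of
`F'` at the origin, and `f = o(|x|^(1-n))`.

The differential equation gives `(D - λ) K γ = 0` off the origin (`IsRadialProfile.dirac_kernel`).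
The two limits give `K = O(|x|^(1-n))`, so `K` is locally integrable and the integrals outside small
balls converge to the integral over all of `ℝⁿ`. That integral is evaluated without boundary terms
(`IsRadialProfile.integral_inner_kernel`): `K` is multiplied by a smooth cutoff vanishing for `|x| ≤
δ`, and `D` is moved across by its formal self-adjointness. Only the Clifford product of the
gradient of the cutoff with `K` survives. After the substitution `x = δ y`, dominated convergence
replaces `K` by its leading part `-x · γ / (ω |x|^n)`, where `ω` is the volume of the unit sphere.
Because `x · x = -|x|²`, what remains is a radial integral equal to `1`.

It remains to see that each formula for `f_λ` has such a profile. In `s = |x|²` and with `m =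
(n-2)/2`, each is a Frobenius expansion `s^(-m) A(s) + log s · B(s) + C(s)` with entire `A`, `B`,
`C`. The equation becomes recurrences for the coefficients, which follow from the functional
equation of `Γ` and the increments of the digamma function. The normalisation fixes the constant in
front of `Y_m`. The added multiples of `J_m` are regular solutions and do not affect the
singularity. -/

/-- Clifford multiplication as a continuous linear map. -/
def SpinorModule.cliffordL (σ : SpinorModule n S) : E n →L[ℝ] (S →L[ℂ] S) :=
  LinearMap.toContinuousLinearMap σ.clifford

/-- The action of Clifford multiplication on a fixed spinor. -/
def SpinorModule.cliffordAt (σ : SpinorModule n S) (φ : S) : E n →L[ℝ] S :=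
  LinearMap.toContinuousLinearMap
    { toFun := fun v => σ.clifford v φ
      map_add' := fun v w => by simp
      map_smul' := fun r v => by simp }

theorem SpinorModule.cliffordAt_apply (σ : SpinorModule n S) (φ : S) (v : E n) :
    σ.cliffordAt φ v = σ.clifford v φ := rfl

theorem SpinorModule.clifford_real_smul (σ : SpinorModule n S) (v : E n) (r : ℝ) (φ : S) :
    σ.clifford v (r • φ) = r • σ.clifford v φ := by
  rw [← Complex.coe_smul, map_smul, Complex.coe_smul]

theorem SpinorModule.sum_smul_clifford (σ : SpinorModule n S) (v : E n) (φ : S) :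
    ∑ i, v i • σ.clifford (EuclideanSpace.single i 1) φ = σ.clifford v φ := by
  have h : v = ∑ i, v i • EuclideanSpace.single i (1 : ℝ) := by
    ext j
    simp [Pi.single_apply]
  conv_rhs => rw [h]
  simp [map_sum]

theorem inner_real_smul_right (r : ℝ) (φ ψ : S) : inner ℂ φ (r • ψ) = r * inner ℂ φ ψ := by
  rw [← Complex.coe_smul, inner_smul_right]

theorem inner_real_smul_left (r : ℝ) (φ ψ : S) : inner ℂ (r • φ) ψ = r * inner ℂ φ ψ := by
  rw [← Complex.coe_smul, inner_smul_left, Complex.conj_ofReal]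

/-- The Leibniz rule for the product of a function with radial gradient and a spinor. -/
theorem dirac_smul_of_radial (σ : SpinorModule n S) {g : E n → ℝ} {u : E n → S} {x : E n} {a : ℝ}
    (hg : HasFDerivAt g (a • innerSL ℝ x) x) (hu : DifferentiableAt ℝ u x) :
    dirac σ (fun z => g z • u z) x = g x • dirac σ u x + a • σ.clifford x (u x) := by
  have h := (hg.smul hu.hasFDerivAt).fderiv
  have h' : fderiv ℝ (fun z => g z • u z) x = _ := h
  unfold dirac
  rw [h', Finset.smul_sum, ← σ.sum_smul_clifford x, Finset.smul_sum, ← Finset.sum_add_distrib]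
  refine Finset.sum_congr rfl fun i _ => ?_
  have hi : inner ℝ x (EuclideanSpace.single i (1 : ℝ)) = x i := by
    simp [EuclideanSpace.inner_single_right]
  simp [σ.clifford_real_smul, hi, smul_smul]

theorem dirac_const (σ : SpinorModule n S) (φ : S) (x : E n) : dirac σ (fun _ => φ) x = 0 := by
  simp [dirac]

theorem dirac_add (σ : SpinorModule n S) {u v : E n → S} {x : E n}
    (hu : DifferentiableAt ℝ u x) (hv : DifferentiableAt ℝ v x) :
    dirac σ (fun z => u z + v z) x = dirac σ u x + dirac σ v x := by
  have h : fderiv ℝ (fun z => u z + v z) x = _ := (hu.hasFDerivAt.add hv.hasFDerivAt).fderiv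
  simp [dirac, h, Finset.sum_add_distrib]

theorem dirac_congr (σ : SpinorModule n S) {u v : E n → S} {x : E n} (h : u =ᶠ[𝓝 x] v) :
    dirac σ u x = dirac σ v x := by
  unfold dirac
  rw [h.fderiv_eq]

theorem dirac_clifford (σ : SpinorModule n S) (φ : S) (x : E n) :
    dirac σ (fun z => σ.clifford z φ) x = -((n : ℝ) • φ) := by
  have h : fderiv ℝ (fun z => σ.clifford z φ) x = σ.cliffordAt φ :=
    (σ.cliffordAt φ).hasFDerivAt.fderiv
  simp only [dirac, h, σ.cliffordAt_apply, σ.clifford_sq]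
  simp [← Nat.cast_smul_eq_nsmul ℝ]

theorem dirac_comp_add_right (σ : SpinorModule n S) (ψ : E n → S) (p x : E n) :
    dirac σ (fun z => ψ (z + p)) x = dirac σ ψ (x + p) := by
  simp [dirac, fderiv_comp_add_right]

theorem continuous_dirac (σ : SpinorModule n S) {ψ : E n → S} (hψ : ContDiff ℝ 1 ψ) :
    Continuous (dirac σ ψ) := by
  unfold dirac
  have := hψ.continuous_fderiv one_ne_zero
  fun_prop

theorem hasCompactSupport_dirac (σ : SpinorModule n S) {ψ : E n → S} (hψ : HasCompactSupport ψ) :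
    HasCompactSupport (dirac σ ψ) := by
  refine (hψ.fderiv (𝕜 := ℝ)).mono' ?_
  refine subset_trans (fun x hx => ?_) subset_closure
  rw [Function.mem_support] at hx ⊢
  contrapose! hx
  simp [dirac, hx]

/-- Integration by parts against the constant function `1`. -/
theorem integral_fderiv_apply_eq_zero {g : E n → ℂ} (hg : ContDiff ℝ 1 g)
    (hc : HasCompactSupport g) (v : E n) : ∫ x, fderiv ℝ g x v = 0 := by
  have h1 : Integrable (fun x => fderiv ℝ g x v) := by
    refine Continuous.integrable_of_hasCompactSupport ?_ (hc.fderiv_apply ℝ v)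
    have := hg.continuous_fderiv one_ne_zero
    fun_prop
  have h2 : Integrable g := hg.continuous.integrable_of_hasCompactSupport hc
  have h := integral_mul_fderiv_eq_neg_fderiv_mul_of_integrable (μ := (volume : Measure (E n)))
    (𝕜 := ℂ) (f := fun _ => (1 : ℂ)) (g := g) (v := v) (by simp) (by simpa using h1)
    (by simpa using h2) (fun x _ => differentiableAt_const _)
    (fun x _ => hg.differentiable one_ne_zero x)
  simpa using h

/-- The Dirac operator is formally self-adjoint. -/
theorem integral_inner_dirac (σ : SpinorModule n S) {ψ u : E n → S} (hψ : ContDiff ℝ 1 ψ)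
    (hc : HasCompactSupport ψ) (hu : ContDiff ℝ 1 u) :
    ∫ x, inner ℂ (dirac σ ψ x) (u x) = ∫ x, inner ℂ (ψ x) (dirac σ u x) := by
  have hcu : ∀ v, ContDiff ℝ 1 fun x => σ.clifford v (u x) := fun v =>
    ((σ.clifford v).restrictScalars ℝ).contDiff.comp hu
  have hg : ∀ v, ContDiff ℝ 1 fun x => inner ℂ (ψ x) (σ.clifford v (u x)) := fun v =>
    hψ.inner ℂ (hcu v)
  have hgc : ∀ v, HasCompactSupport fun x => inner ℂ (ψ x) (σ.clifford v (u x)) := fun v => by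
    refine hc.mono fun x hx => ?_
    rw [Function.mem_support] at hx ⊢
    contrapose! hx
    simp [hx]
  -- The two integrands differ by the divergence of the vector field with components `⟨ψ, Eᵢ · u⟩`;
  -- skewness of Clifford multiplication supplies the sign.
  have hd : ∀ x, ∑ i, fderiv ℝ (fun x => inner ℂ (ψ x)
      (σ.clifford (EuclideanSpace.single i 1) (u x))) x (EuclideanSpace.single i 1)
      = inner ℂ (ψ x) (dirac σ u x) - inner ℂ (dirac σ ψ x) (u x) := by
    intro x
    simp only [dirac, inner_sum, sum_inner, ← Finset.sum_sub_distrib]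
    refine Finset.sum_congr rfl fun i _ => ?_
    rw [fderiv_inner_apply ℂ (hψ.differentiable one_ne_zero x)
      ((hcu _).differentiable one_ne_zero x), σ.clifford_skew, sub_neg_eq_add]
    have h : HasFDerivAt (fun x => σ.clifford (EuclideanSpace.single i 1) (u x)) _ x :=
      ((σ.clifford (EuclideanSpace.single i 1)).restrictScalars ℝ).hasFDerivAt.comp x
        (hu.differentiable one_ne_zero x).hasFDerivAt
    rw [h.fderiv]
    rfl
  have i1 : Integrable fun x => inner ℂ (ψ x) (dirac σ u x) := by
    refine Continuous.integrable_of_hasCompactSupport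
      (hψ.continuous.inner (continuous_dirac σ hu)) (hc.mono fun x hx => ?_)
    rw [Function.mem_support] at hx ⊢
    contrapose! hx
    simp [hx]
  have i2 : Integrable fun x => inner ℂ (dirac σ ψ x) (u x) := by
    refine Continuous.integrable_of_hasCompactSupport
      ((continuous_dirac σ hψ).inner hu.continuous)
      ((hasCompactSupport_dirac σ hc).mono fun x hx => ?_)
    rw [Function.mem_support] at hx ⊢
    contrapose! hx
    simp [hx]
  have h0 : ∫ x, (inner ℂ (ψ x) (dirac σ u x) - inner ℂ (dirac σ ψ x) (u x)) = 0 := by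
    simp_rw [← hd]
    rw [integral_finsetSum]
    · exact Finset.sum_eq_zero fun i _ => integral_fderiv_apply_eq_zero (hg _) (hgc _) _
    · intro i _
      refine Continuous.integrable_of_hasCompactSupport ?_ ((hgc _).fderiv_apply ℝ _)
      have := (hg (EuclideanSpace.single i 1)).continuous_fderiv one_ne_zero
      fun_prop
  rw [integral_sub i1 i2, sub_eq_zero] at h0
  exact h0.symm

/-! ### Radial solutions of the Helmholtz equation and the associated kernel -/

/-- `x ↦ F (‖x‖ ^ 2)` is a fundamental solution of `-Δ - lam ^ 2` on `ℝⁿ`. -/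
structure IsRadialProfile (n : ℕ) (lam : ℝ) (F : ℝ → ℝ) : Prop where
  contDiffOn : ContDiffOn ℝ ∞ F (Set.Ioi 0)
  -- For `f(x) = F(|x|²)` the Laplacian is `4 s F'' + 2 n F'` at `s = |x|²`, so this is `Δf + λ² f =
  -- 0`.
  ode : ∀ s, 0 < s → 4 * s * deriv (deriv F) s + 2 * n * deriv F s + lam ^ 2 * F s = 0
  -- The gradient is `2 F'(|x|²) x`, so its flux through the sphere of radius `r` is `2 ω rⁿ
  -- F'(r²)`, with `ω` the volume of the unit sphere; the limit says that this flux tends to `-1`.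
  tendsto_deriv : Tendsto (fun r => r ^ n * deriv F (r ^ 2)) (𝓝[>] 0)
    (𝓝 (-(1 / (2 * sphereVol n))))
  tendsto_self : Tendsto (fun r => r ^ (n - 1) * F (r ^ 2)) (𝓝[>] 0) (𝓝 0)

/-- The kernel `z ↦ (D + lam) (F (‖·‖ ^ 2)) (z)`. -/
def radialKernel (σ : SpinorModule n S) (lam : ℝ) (F : ℝ → ℝ) (z : E n) : S →L[ℂ] S :=
  (2 * deriv F (‖z‖ ^ 2)) • σ.clifford z + (lam * F (‖z‖ ^ 2)) • ContinuousLinearMap.id ℂ S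

theorem radialKernel_apply (σ : SpinorModule n S) (lam : ℝ) (F : ℝ → ℝ) (z : E n) (φ : S) :
    radialKernel σ lam F z φ
      = (2 * deriv F (‖z‖ ^ 2)) • σ.clifford z φ + (lam * F (‖z‖ ^ 2)) • φ := rfl

theorem hasFDerivAt_comp_norm_sq {f : ℝ → ℝ} {f' : ℝ} {x : E n} (hf : HasDerivAt f f' (‖x‖ ^ 2)) :
    HasFDerivAt (fun z : E n => f (‖z‖ ^ 2)) ((2 * f') • innerSL ℝ x) x := by
  have h1 : HasFDerivAt (fun z : E n => ‖z‖ ^ 2) (2 • (innerSL ℝ) x) x := by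
    simpa using (hasFDerivAt_id x).norm_sq
  refine (hf.comp_hasFDerivAt x h1).congr_fderiv ?_
  ext v
  simp
  ring

variable {lam : ℝ} {F : ℝ → ℝ}

theorem IsRadialProfile.contDiffOn_deriv (hF : IsRadialProfile n lam F) :
    ContDiffOn ℝ ∞ (deriv F) (Set.Ioi 0) :=
  ((contDiffOn_infty_iff_deriv_of_isOpen isOpen_Ioi).1 hF.contDiffOn).2

theorem IsRadialProfile.hasDerivAt (hF : IsRadialProfile n lam F) {s : ℝ} (hs : 0 < s) :
    HasDerivAt F (deriv F s) s :=
  ((hF.contDiffOn.differentiableOn (by simp)).differentiableAt (Ioi_mem_nhds hs)).hasDerivAt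

theorem IsRadialProfile.hasDerivAt_deriv (hF : IsRadialProfile n lam F) {s : ℝ} (hs : 0 < s) :
    HasDerivAt (deriv F) (deriv (deriv F) s) s :=
  ((hF.contDiffOn_deriv.differentiableOn (by simp)).differentiableAt
    (Ioi_mem_nhds hs)).hasDerivAt

theorem IsRadialProfile.dirac_smul_const (hF : IsRadialProfile n lam F) (σ : SpinorModule n S)
    (φ : S) {x : E n} (hx : x ≠ 0) :
    dirac σ (fun z => F (‖z‖ ^ 2) • φ) x = (2 * deriv F (‖x‖ ^ 2)) • σ.clifford x φ := by
  have hs : 0 < ‖x‖ ^ 2 := by positivity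
  have h := dirac_smul_of_radial σ (hasFDerivAt_comp_norm_sq (hF.hasDerivAt hs))
    (differentiableAt_const φ)
  rw [h, dirac_const, smul_zero, zero_add]

theorem IsRadialProfile.contDiffOn_kernel (hF : IsRadialProfile n lam F) (σ : SpinorModule n S) :
    ContDiffOn ℝ ∞ (radialKernel σ lam F) {0}ᶜ := by
  have hn : ContDiffOn ℝ ∞ (fun z : E n => ‖z‖ ^ 2) {0}ᶜ := (contDiff_norm_sq ℝ).contDiffOn
  have hm : Set.MapsTo (fun z : E n => ‖z‖ ^ 2) {0}ᶜ (Set.Ioi 0) := fun z hz => by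
    have : z ≠ 0 := hz
    simp only [Set.mem_Ioi]
    positivity
  have h1 := hF.contDiffOn.comp hn hm
  have h2 := hF.contDiffOn_deriv.comp hn hm
  exact ((contDiffOn_const.mul h2).smul σ.cliffordL.contDiff.contDiffOn).add
    ((contDiffOn_const.mul h1).smul contDiffOn_const)

theorem IsRadialProfile.contDiffOn_kernel_apply (hF : IsRadialProfile n lam F)
    (σ : SpinorModule n S) (φ : S) :
    ContDiffOn ℝ ∞ (fun z => radialKernel σ lam F z φ) {0}ᶜ :=
  ((ContinuousLinearMap.apply ℂ S φ).restrictScalars ℝ).contDiff.comp_contDiffOn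
    (hF.contDiffOn_kernel σ)

/-- Away from the origin the kernel solves `(D - lam) u = 0`. -/
theorem IsRadialProfile.dirac_kernel (hF : IsRadialProfile n lam F) (σ : SpinorModule n S)
    (φ : S) {x : E n} (hx : x ≠ 0) :
    dirac σ (fun z => radialKernel σ lam F z φ) x = lam • radialKernel σ lam F x φ := by
  have hs : 0 < ‖x‖ ^ 2 := by positivity
  have d1 := hasFDerivAt_comp_norm_sq ((hF.hasDerivAt_deriv hs).const_mul 2)
  have d2 := hasFDerivAt_comp_norm_sq ((hF.hasDerivAt hs).const_mul lam)
  have dc : DifferentiableAt ℝ (fun z => σ.clifford z φ) x := (σ.cliffordAt φ).differentiableAt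
  have d3 : DifferentiableAt ℝ (fun z => (2 * deriv F (‖z‖ ^ 2)) • σ.clifford z φ) x :=
    d1.differentiableAt.smul dc
  have e1 := dirac_smul_of_radial σ d1 dc
  have e2 := dirac_smul_of_radial σ d2 (differentiableAt_const φ)
  simp only [radialKernel_apply]
  rw [dirac_add σ d3 (d2.differentiableAt.smul_const φ), e1, e2, dirac_clifford, dirac_const, σ.clifford_sq]
  -- Apart from the `λ`-proportional part `λ · 2F' x·φ`, which already matches, the coefficients of
  -- `φ` agree exactly by the radial Helmholtz equation.
  have h := hF.ode _ hs
  have h3 : (2 * deriv F (‖x‖ ^ 2)) * (n : ℝ)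
      + 2 * (2 * deriv (deriv F) (‖x‖ ^ 2)) * ‖x‖ ^ 2 = - (lam * (lam * F (‖x‖ ^ 2))) := by
    linarith
  have h4 := congrArg (fun t : ℝ => -(t • φ)) h3
  simp only [add_smul, neg_smul, neg_neg] at h4
  rw [smul_zero, zero_add, smul_add, smul_neg, smul_neg, smul_smul, smul_smul, smul_smul,
    smul_smul, ← h4, neg_add, add_comm]
  congr 1
  congr 1
  ring

end Dirac

/-! ### Bounds and integrability of the kernel -/

theorem exists_bound_Ioc_of_tendsto {g : ℝ → ℝ} {c : ℝ} (hg : ContinuousOn g (Set.Ioi 0))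
    (hc : Tendsto g (𝓝[>] 0) (𝓝 c)) (R : ℝ) : ∃ C, 0 ≤ C ∧ ∀ r ∈ Set.Ioc 0 R, |g r| ≤ C := by
  have h1 : ∀ᶠ r in 𝓝[>] 0, |g r| < |c| + 1 := hc.abs.eventually_lt_const (by linarith)
  obtain ⟨δ, hδ, h2⟩ := mem_nhdsGT_iff_exists_Ioo_subset.1 h1
  have hδ0 : 0 < δ := hδ
  obtain ⟨C, hC⟩ := (isCompact_Icc (a := δ) (b := R)).exists_bound_of_continuousOn
    (hg.mono fun r hr => lt_of_lt_of_le hδ0 hr.1)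
  refine ⟨max (|c| + 1) C, le_max_of_le_left (by positivity), fun r hr => ?_⟩
  rcases lt_or_ge r δ with h | h
  · exact le_max_of_le_left (h2 ⟨hr.1, h⟩ : |g r| < |c| + 1).le
  · exact le_max_of_le_right (hC r ⟨h, hr.2⟩)

section Kernel

variable {n : ℕ} {S : Type*} [NormedAddCommGroup S] [InnerProductSpace ℂ S]
  {lam : ℝ} {F : ℝ → ℝ}

/-- Both limits in `IsRadialProfile` bound the corresponding expressions on `(0, R]`, and Clifford
multiplication by `z` contributes one more factor `‖z‖`. The resulting order `‖z‖^(1-n)` is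
integrable at the origin. -/
theorem IsRadialProfile.exists_kernel_bound (hn : n ≠ 0) (hF : IsRadialProfile n lam F)
    (σ : SpinorModule n S) (R : ℝ) :
    ∃ C, 0 ≤ C ∧ ∀ z : E n, z ≠ 0 → ‖z‖ ≤ R → ‖z‖ ^ (n - 1) * ‖radialKernel σ lam F z‖ ≤ C := by
  have hsq : Set.MapsTo (fun r : ℝ => r ^ 2) (Set.Ioi 0) (Set.Ioi 0) := fun r hr => by
    have : 0 < r := hr
    simp only [Set.mem_Ioi]
    positivity
  have c0 : ContinuousOn (fun r : ℝ => r ^ 2) (Set.Ioi 0) := by fun_prop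
  have c1 := hF.contDiffOn.continuousOn.comp c0 hsq
  have c2 := hF.contDiffOn_deriv.continuousOn.comp c0 hsq
  obtain ⟨C₁, hC₁, h₁⟩ := exists_bound_Ioc_of_tendsto
    ((continuousOn_id.pow n).mul c2) hF.tendsto_deriv R
  obtain ⟨C₂, hC₂, h₂⟩ := exists_bound_Ioc_of_tendsto
    ((continuousOn_id.pow (n - 1)).mul c1) hF.tendsto_self R
  refine ⟨2 * ‖σ.cliffordL‖ * C₁ + |lam| * C₂ * ‖ContinuousLinearMap.id ℂ S‖, by positivity,
    fun z hz hzR => ?_⟩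
  have hr : ‖z‖ ∈ Set.Ioc 0 R := ⟨norm_pos_iff.2 hz, hzR⟩
  have b1 := h₁ _ hr
  have b2 := h₂ _ hr
  simp only [Pi.mul_apply, Pi.pow_apply, id_eq, Function.comp_apply, abs_mul, abs_pow,
    abs_norm] at b1 b2
  have hp : ‖z‖ ^ n = ‖z‖ ^ (n - 1) * ‖z‖ := by
    rw [← pow_succ, Nat.sub_add_cancel (Nat.one_le_iff_ne_zero.2 hn)]
  calc ‖z‖ ^ (n - 1) * ‖radialKernel σ lam F z‖
      ≤ ‖z‖ ^ (n - 1) * (2 * |deriv F (‖z‖ ^ 2)| * (‖σ.cliffordL‖ * ‖z‖)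
          + |lam| * |F (‖z‖ ^ 2)| * ‖ContinuousLinearMap.id ℂ S‖) := by
        gcongr
        refine (norm_add_le _ _).trans ?_
        rw [norm_smul, norm_smul, Real.norm_eq_abs, Real.norm_eq_abs, abs_mul, abs_mul, abs_two]
        gcongr
        exact σ.cliffordL.le_opNorm z
    _ = 2 * ‖σ.cliffordL‖ * (‖z‖ ^ n * |deriv F (‖z‖ ^ 2)|)
          + |lam| * (‖z‖ ^ (n - 1) * |F (‖z‖ ^ 2)|) * ‖ContinuousLinearMap.id ℂ S‖ := by
        rw [hp]
        ring
    _ ≤ _ := by gcongr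

theorem ae_ne_zero (hn : n ≠ 0) : ∀ᵐ z : E n, z ≠ 0 := by
  have : NeZero n := ⟨hn⟩
  exact Measure.ae_ne _ _

theorem IsRadialProfile.aestronglyMeasurable_kernel (hn : n ≠ 0) (hF : IsRadialProfile n lam F)
    (σ : SpinorModule n S) : AEStronglyMeasurable (radialKernel σ lam F) volume := by
  have h := (hF.contDiffOn_kernel σ).continuousOn.aestronglyMeasurable (μ := volume)
    (measurableSet_singleton 0).compl
  have h2 : (volume : Measure (E n)).restrict {0}ᶜ = volume :=
    Measure.restrict_eq_self_of_ae_mem (ae_ne_zero hn)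
  rwa [h2] at h

/-- In polar coordinates the singularity cancels against the density `r^(n-1)`. -/
theorem integrableOn_inv_norm_pow (hn : n ≠ 0) (C R : ℝ) :
    IntegrableOn (fun z : E n => C * (‖z‖ ^ (n - 1))⁻¹) (Metric.closedBall 0 R) := by
  have : NeZero n := ⟨hn⟩
  rw [← integrable_indicator_iff measurableSet_closedBall]
  have h : (Metric.closedBall (0 : E n) R).indicator (fun z : E n => C * (‖z‖ ^ (n - 1))⁻¹)
      = fun z => (Set.Iic R).indicator (fun r => C * (r ^ (n - 1))⁻¹) ‖z‖ := by
    ext z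
    simp [Set.indicator]
  rw [h, integrable_fun_norm_addHaar, finrank_euclideanSpace_fin]
  have h2 : IntegrableOn ((Set.Iic R).indicator fun _ => C) (Set.Ioi (0 : ℝ)) := by
    rw [IntegrableOn, integrable_indicator_iff measurableSet_Iic, IntegrableOn,
      Measure.restrict_restrict measurableSet_Iic, Set.inter_comm, Set.Ioi_inter_Iic]
    exact integrableOn_const (by simp)
  refine h2.congr_fun (fun r hr => ?_) measurableSet_Ioi
  have hr0 : r ≠ 0 := (ne_of_gt hr)
  by_cases hrR : r ∈ Set.Iic R
  · simp only [Set.indicator_of_mem hrR, smul_eq_mul]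
    field_simp
  · simp [Set.indicator_of_notMem hrR]

theorem IsRadialProfile.integrableOn_kernel (hn : n ≠ 0) (hF : IsRadialProfile n lam F)
    (σ : SpinorModule n S) (R : ℝ) :
    IntegrableOn (radialKernel σ lam F) (Metric.closedBall 0 R) := by
  obtain ⟨C, -, hC⟩ := hF.exists_kernel_bound hn σ R
  refine Integrable.mono' (integrableOn_inv_norm_pow hn C R)
    (hF.aestronglyMeasurable_kernel hn σ).restrict ?_
  filter_upwards [ae_restrict_of_ae (ae_ne_zero hn), ae_restrict_mem measurableSet_closedBall]
    with z hz hzR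
  have := hC z hz (by simpa using hzR)
  have hp : 0 < ‖z‖ ^ (n - 1) := by positivity
  rw [← div_eq_mul_inv, le_div_iff₀ hp, mul_comm]
  exact this

/-- The shear `(x, y) ↦ (x - y, y)` preserves Lebesgue measure and maps a compact set into a product
of two balls, where the kernel depends on the first factor only and the second has finite measure.
-/
theorem IsRadialProfile.locallyIntegrable_kernel_sub (hn : n ≠ 0) (hF : IsRadialProfile n lam F)
    (σ : SpinorModule n S) :
    LocallyIntegrable (fun q : E n × E n => radialKernel σ lam F (q.1 - q.2)) volume := by
  rw [locallyIntegrable_iff]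
  intro K hK
  obtain ⟨R, hR⟩ := (hK.image (continuous_fst.sub continuous_snd)).isBounded.subset_closedBall 0
  obtain ⟨R', hR'⟩ := (hK.image continuous_snd).isBounded.subset_closedBall 0
  have h1 : IntegrableOn (fun q : E n × E n => radialKernel σ lam F q.1)
      (Metric.closedBall 0 R ×ˢ Metric.closedBall 0 R') (volume.prod volume) := by
    rw [IntegrableOn, ← Measure.prod_restrict]
    have : IsFiniteMeasure ((volume : Measure (E n)).restrict (Metric.closedBall 0 R')) :=
      ⟨by simpa using measure_closedBall_lt_top⟩
    exact (hF.integrableOn_kernel hn σ R).comp_fst _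
  let e : E n × E n ≃ᵐ E n × E n :=
    { toFun := fun q => (q.1 - q.2, q.2)
      invFun := fun q => (q.1 + q.2, q.2)
      left_inv := fun q => by simp
      right_inv := fun q => by simp
      measurable_toFun := (measurable_fst.sub measurable_snd).prodMk measurable_snd
      measurable_invFun := (measurable_fst.add measurable_snd).prodMk measurable_snd }
  have he : MeasurePreserving e (volume.prod volume) (volume.prod volume) :=
    measurePreserving_sub_prod (volume : Measure (E n)) volume
  have h2 := (he.integrableOn_comp_preimage e.measurableEmbedding).2 h1
  refine IntegrableOn.mono_set h2 fun q hq => ?_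
  exact ⟨hR ⟨q, hq, rfl⟩, hR' ⟨q, hq, rfl⟩⟩

theorem IsRadialProfile.integrable_inner_kernel (hn : n ≠ 0) (hF : IsRadialProfile n lam F)
    (σ : SpinorModule n S) {g : E n → S} (hg : Continuous g) (hc : HasCompactSupport g) (φ : S) :
    Integrable fun x => inner ℂ (g x) (radialKernel σ lam F x φ) := by
  obtain ⟨R, hR⟩ := hc.isCompact.isBounded.subset_closedBall 0
  obtain ⟨M, hM⟩ := hg.bounded_above_of_compact_support hc
  have h1 : IntegrableOn (fun x => inner ℂ (g x) (radialKernel σ lam F x φ))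
      (Metric.closedBall 0 R) := by
    refine Integrable.mono' (((hF.integrableOn_kernel hn σ R).norm.const_mul M).mul_const ‖φ‖)
      ?_ (Eventually.of_forall fun x => ?_)
    · exact (hg.aestronglyMeasurable.inner ((ContinuousLinearMap.apply ℂ S
        φ).continuous.comp_aestronglyMeasurable (hF.aestronglyMeasurable_kernel hn σ))).restrict
    · refine (norm_inner_le_norm _ _).trans ?_
      rw [mul_assoc]
      exact mul_le_mul (hM x) ((radialKernel σ lam F x).le_opNorm φ) (norm_nonneg _)
        ((norm_nonneg _).trans (hM x))
  rw [integrableOn_iff_integrable_of_support_subset] at h1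
  · exact h1
  · intro x hx
    refine hR (subset_closure ?_)
    rw [Function.mem_support] at hx ⊢
    contrapose! hx
    simp [hx]

end Kernel

/-! ### A smooth cutoff -/

/-- A smooth function on `ℝ` equal to `0` on `(-∞, 1]` and to `1` on `[2, ∞)`. -/
def cutoff (t : ℝ) : ℝ := Real.smoothTransition (t - 1)

theorem contDiff_cutoff : ContDiff ℝ ∞ cutoff :=
  Real.smoothTransition.contDiff.comp (contDiff_id.sub contDiff_const)

theorem hasDerivAt_cutoff (t : ℝ) : HasDerivAt cutoff (deriv cutoff t) t :=
  (contDiff_cutoff.differentiable (by simp) t).hasDerivAt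

theorem continuous_deriv_cutoff : Continuous (deriv cutoff) :=
  contDiff_cutoff.continuous_deriv (by simp)

theorem cutoff_of_le {t : ℝ} (h : t ≤ 1) : cutoff t = 0 :=
  Real.smoothTransition.zero_of_nonpos (by linarith)

theorem cutoff_of_ge {t : ℝ} (h : 2 ≤ t) : cutoff t = 1 :=
  Real.smoothTransition.one_of_one_le (by linarith)

theorem abs_cutoff_le (t : ℝ) : |cutoff t| ≤ 1 := by
  rw [cutoff, abs_of_nonneg (Real.smoothTransition.nonneg _)]
  exact Real.smoothTransition.le_one _

theorem deriv_cutoff_of_lt {t : ℝ} (h : t < 1) : deriv cutoff t = 0 := by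
  have : cutoff =ᶠ[𝓝 t] fun _ => 0 := by
    filter_upwards [Iio_mem_nhds h] with s hs
    exact cutoff_of_le (le_of_lt hs)
  simp [this.deriv_eq]

theorem deriv_cutoff_of_gt {t : ℝ} (h : 2 < t) : deriv cutoff t = 0 := by
  have : cutoff =ᶠ[𝓝 t] fun _ => 1 := by
    filter_upwards [Ioi_mem_nhds h] with s hs
    exact cutoff_of_ge (le_of_lt hs)
  simp [this.deriv_eq]

theorem exists_bound_deriv_cutoff : ∃ M, 0 ≤ M ∧ ∀ t, |deriv cutoff t| ≤ M := by
  obtain ⟨M, hM⟩ := (isCompact_Icc (a := (1 : ℝ)) (b := 2)).exists_bound_of_continuousOn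
    continuous_deriv_cutoff.continuousOn
  refine ⟨M, (norm_nonneg _).trans (hM 1 (by norm_num)), fun t => ?_⟩
  have h0 := (norm_nonneg _).trans (hM 1 (by norm_num))
  rcases lt_or_ge t 1 with h | h
  · simpa [deriv_cutoff_of_lt h] using h0
  rcases lt_or_ge 2 t with h' | h'
  · simpa [deriv_cutoff_of_gt h'] using h0
  exact hM t ⟨h, h'⟩

/-- The integrand is the derivative of `cutoff (r ^ 2)`, which rises from `0` to `1`. -/
theorem integral_deriv_cutoff_sq : ∫ r in Set.Ioi (0 : ℝ), 2 * r * deriv cutoff (r ^ 2) = 1 := by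
  have hd : ∀ r : ℝ, HasDerivAt (fun r => cutoff (r ^ 2)) (2 * r * deriv cutoff (r ^ 2)) r := by
    intro r
    have h := (hasDerivAt_cutoff (r ^ 2)).comp r (hasDerivAt_pow 2 r)
    refine h.congr_deriv ?_
    push_cast
    ring
  have hc : Continuous fun r : ℝ => 2 * r * deriv cutoff (r ^ 2) := by
    have := continuous_deriv_cutoff
    fun_prop
  have hs : HasCompactSupport fun r : ℝ => 2 * r * deriv cutoff (r ^ 2) := by
    refine HasCompactSupport.intro (isCompact_Icc (a := (-2 : ℝ)) (b := 2)) fun r hr => ?_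
    rw [deriv_cutoff_of_gt, mul_zero]
    by_contra h
    exact hr ⟨by nlinarith, by nlinarith⟩
  have h := integral_Ioi_of_hasDerivAt_of_tendsto (a := (0 : ℝ)) (m := 1)
    (hd 0).continuousAt.continuousWithinAt (fun x _ => hd x)
    (hc.integrable_of_hasCompactSupport hs).integrableOn
    (tendsto_const_nhds.congr' (by
      filter_upwards [eventually_ge_atTop 2] with r hr
      exact (cutoff_of_ge (by nlinarith)).symm))
  rw [h, cutoff_of_le (by norm_num), sub_zero]

/-! ### Sphere volume and the normalising integral -/

theorem sphereVol_eq (n : ℕ) :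
    sphereVol n = n * (volume : Measure (E n)).real (Metric.ball 0 1) := by
  have h := Measure.toSphere_real_apply_univ (volume : Measure (E n))
  rwa [finrank_euclideanSpace_fin] at h

theorem sphereVol_pos {n : ℕ} (hn : n ≠ 0) : 0 < sphereVol n := by
  rw [sphereVol_eq]
  have : 0 < (volume : Measure (E n)).real (Metric.ball 0 1) :=
    ENNReal.toReal_pos (Metric.measure_ball_pos _ _ one_pos).ne' measure_ball_lt_top.ne
  positivity

/-- This is the constant that appears in the limit `δ → 0`. In polar coordinates the powers of `r`
combine to a single `r`, and the volume of the sphere cancels, leaving `integral_deriv_cutoff_sq`.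
-/
theorem integral_deriv_cutoff_norm_sq {n : ℕ} (hn : n ≠ 0) :
    ∫ y : E n, 2 * deriv cutoff (‖y‖ ^ 2) * (‖y‖ ^ 2 * (‖y‖ ^ n)⁻¹ / sphereVol n) = 1 := by
  have : NeZero n := ⟨hn⟩
  have hS := (sphereVol_pos hn).ne'
  rw [integral_fun_norm_addHaar volume fun r : ℝ =>
    2 * deriv cutoff (r ^ 2) * (r ^ 2 * (r ^ n)⁻¹ / sphereVol n), finrank_euclideanSpace_fin]
  have h : ∀ r ∈ Set.Ioi (0 : ℝ), r ^ (n - 1) •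
      (2 * deriv cutoff (r ^ 2) * (r ^ 2 * (r ^ n)⁻¹ / sphereVol n))
      = (sphereVol n)⁻¹ * (2 * r * deriv cutoff (r ^ 2)) := by
    intro r hr
    have hr0 : r ≠ 0 := ne_of_gt hr
    have hp : r ^ n = r ^ (n - 1) * r := by
      rw [← pow_succ, Nat.sub_add_cancel (Nat.one_le_iff_ne_zero.2 hn)]
    rw [hp, smul_eq_mul]
    field_simp
  rw [setIntegral_congr_fun measurableSet_Ioi h, integral_const_mul, integral_deriv_cutoff_sq,
    nsmul_eq_mul, smul_eq_mul, ← mul_assoc, ← sphereVol_eq, mul_one, mul_inv_cancel₀ hS]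

/-! ### The kernel is a fundamental solution -/

section Kernel

variable {n : ℕ} {S : Type*} [NormedAddCommGroup S] [InnerProductSpace ℂ S]
  {lam : ℝ} {F : ℝ → ℝ}

/-- The kernel, cut off near the origin at scale `δ`. -/
def cutKernel (σ : SpinorModule n S) (lam : ℝ) (F : ℝ → ℝ) (φ : S) (δ : ℝ) (x : E n) : S :=
  cutoff (‖x‖ ^ 2 / δ ^ 2) • radialKernel σ lam F x φ

/-- Vanishing near the origin removes the singularity. For `δ = 0` the quotient is `0` by
convention, so the cut kernel is identically zero and no sign condition on `δ` is needed for its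
regularity. -/
theorem cutKernel_eventuallyEq_zero (σ : SpinorModule n S) (φ : S) {δ : ℝ} {x : E n}
    (hx : ‖x‖ ^ 2 / δ ^ 2 < 1) : cutKernel σ lam F φ δ =ᶠ[𝓝 x] fun _ => 0 := by
  have hc : Continuous fun x : E n => ‖x‖ ^ 2 / δ ^ 2 := by fun_prop
  filter_upwards [hc.continuousAt.eventually_lt continuousAt_const hx] with z hz
  rw [cutKernel, cutoff_of_le hz.le, zero_smul]

theorem hasFDerivAt_cutoff_norm_sq (δ : ℝ) (x : E n) :
    HasFDerivAt (fun z : E n => cutoff (‖z‖ ^ 2 / δ ^ 2))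
      ((2 * (deriv cutoff (‖x‖ ^ 2 / δ ^ 2) / δ ^ 2)) • innerSL ℝ x) x := by
  refine hasFDerivAt_comp_norm_sq (f := fun s => cutoff (s / δ ^ 2)) ?_
  have h := (hasDerivAt_cutoff (‖x‖ ^ 2 / δ ^ 2)).comp (‖x‖ ^ 2)
    ((hasDerivAt_id (‖x‖ ^ 2)).div_const (δ ^ 2))
  refine h.congr_deriv ?_
  rw [mul_one_div]

theorem IsRadialProfile.contDiff_cutKernel (hF : IsRadialProfile n lam F)
    (σ : SpinorModule n S) (φ : S) (δ : ℝ) : ContDiff ℝ 1 (cutKernel σ lam F φ δ) := by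
  rw [contDiff_iff_contDiffAt]
  intro x
  rcases lt_or_ge (‖x‖ ^ 2 / δ ^ 2) 1 with h | h
  · exact contDiffAt_const.congr_of_eventuallyEq (cutKernel_eventuallyEq_zero σ φ h)
  · have hx : x ≠ 0 := by
      rintro rfl
      norm_num at h
    have h1 : ContDiff ℝ 1 fun z : E n => cutoff (‖z‖ ^ 2 / δ ^ 2) :=
      (contDiff_cutoff.of_le (by simp)).comp ((contDiff_norm_sq ℝ).div_const _)
    exact h1.contDiffAt.smul (((hF.contDiffOn_kernel_apply σ φ).contDiffAt
      (isOpen_compl_singleton.mem_nhds hx)).of_le (by simp))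

/-- Off the origin this is the Leibniz rule together with `(D - λ) K φ = 0`; near the origin both
sides vanish. -/
theorem IsRadialProfile.dirac_cutKernel (hF : IsRadialProfile n lam F)
    (σ : SpinorModule n S) (φ : S) (δ : ℝ) (x : E n) :
    dirac σ (cutKernel σ lam F φ δ) x = lam • cutKernel σ lam F φ δ x
      + (2 * (deriv cutoff (‖x‖ ^ 2 / δ ^ 2) / δ ^ 2)) •
        σ.clifford x (radialKernel σ lam F x φ) := by
  rcases lt_or_ge (‖x‖ ^ 2 / δ ^ 2) 1 with h | h
  · have h0 := cutKernel_eventuallyEq_zero (lam := lam) (F := F) σ φ h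
    rw [dirac_congr σ h0, dirac_const, h0.self_of_nhds, deriv_cutoff_of_lt h]
    simp
  · have hx : x ≠ 0 := by
      rintro rfl
      norm_num at h
    have hd : DifferentiableAt ℝ (fun z => radialKernel σ lam F z φ) x :=
      ((hF.contDiffOn_kernel_apply σ φ).contDiffAt
        (isOpen_compl_singleton.mem_nhds hx)).differentiableAt (by simp)
    have e := dirac_smul_of_radial σ (hasFDerivAt_cutoff_norm_sq δ x) hd
    rw [hF.dirac_kernel σ φ hx, smul_comm] at e
    exact e

theorem integral_comp_smul_of_pos (g : E n → ℂ) {δ : ℝ} (hδ : 0 < δ) :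
    ∫ x, g x = ∫ y, δ ^ n • g (δ • y) := by
  rw [integral_smul, Measure.integral_comp_smul, finrank_euclideanSpace_fin, smul_smul,
    abs_of_pos (by positivity), mul_inv_cancel₀ (by positivity), one_smul]

/-- Testing the cut-off kernel, after rescaling. -/
theorem IsRadialProfile.integral_cutKernel (hn : n ≠ 0) (hF : IsRadialProfile n lam F)
    (σ : SpinorModule n S) (φ : S) {ψ : E n → S} (hψ : ContDiff ℝ 1 ψ) (hc : HasCompactSupport ψ)
    {δ : ℝ} (hδ : 0 < δ) :
    ∫ x, inner ℂ (dirac σ ψ x - lam • ψ x) (cutKernel σ lam F φ δ x)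
      = ∫ y, inner ℂ (ψ (δ • y)) ((2 * deriv cutoff (‖y‖ ^ 2)) •
        σ.clifford y (δ ^ (n - 1) • radialKernel σ lam F (δ • y) φ)) := by
  have hu := hF.contDiff_cutKernel σ φ δ
  have i1 : Integrable fun x => inner ℂ (dirac σ ψ x) (cutKernel σ lam F φ δ x) := by
    refine Continuous.integrable_of_hasCompactSupport
      ((continuous_dirac σ hψ).inner hu.continuous)
      ((hasCompactSupport_dirac σ hc).mono fun x hx => ?_)
    rw [Function.mem_support] at hx ⊢
    contrapose! hx
    simp [hx]
  have i2 : Integrable fun x => inner ℂ (lam • ψ x) (cutKernel σ lam F φ δ x) := by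
    refine Continuous.integrable_of_hasCompactSupport
      ((hψ.continuous.const_smul lam).inner hu.continuous) (hc.mono fun x hx => ?_)
    rw [Function.mem_support] at hx ⊢
    contrapose! hx
    simp [hx]
  have i3 : Integrable fun x => inner ℂ (ψ x) (dirac σ (cutKernel σ lam F φ δ) x) := by
    refine Continuous.integrable_of_hasCompactSupport
      (hψ.continuous.inner (continuous_dirac σ hu)) (hc.mono fun x hx => ?_)
    rw [Function.mem_support] at hx ⊢
    contrapose! hx
    simp [hx]
  simp only [inner_sub_left]
  rw [integral_sub i1 i2, integral_inner_dirac σ hψ hc hu, ← integral_sub i3 i2,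
    integral_comp_smul_of_pos _ hδ]
  refine integral_congr_ae (Eventually.of_forall fun y => ?_)
  -- Counting powers of `δ`: the Jacobian gives `δⁿ`, the derivative of the cutoff `δ⁻²`, and
  -- Clifford multiplication by `δ y` one factor `δ`. The total `δ^(n-1)` is what normalises the
  -- kernel.
  have hp : δ ^ n = δ ^ (n - 1) * δ := by
    rw [← pow_succ, Nat.sub_add_cancel (Nat.one_le_iff_ne_zero.2 hn)]
  have hq : ‖δ • y‖ ^ 2 / δ ^ 2 = ‖y‖ ^ 2 := by
    rw [norm_smul, Real.norm_eq_abs, mul_pow, sq_abs]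
    field_simp
  simp only [hF.dirac_cutKernel, inner_add_right, inner_real_smul_left, inner_real_smul_right,
    add_sub_cancel_left, hq, map_smul, σ.clifford_real_smul, Complex.real_smul, _root_.smul_apply]
  have hδ' : (δ : ℂ) ≠ 0 := by exact_mod_cast hδ.ne'
  rw [hp]
  push_cast
  field_simp

/-- The blow-up of the kernel at the origin is homogeneous of degree `1 - n`: both defining limits
are used along `r = δ ‖y‖`, and the term in `F` itself drops out. -/
theorem IsRadialProfile.tendsto_kernel_smul (hn : n ≠ 0) (hF : IsRadialProfile n lam F)
    (σ : SpinorModule n S) (φ : S) {y : E n} (hy : y ≠ 0) :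
    Tendsto (fun δ : ℝ => δ ^ (n - 1) • radialKernel σ lam F (δ • y) φ) (𝓝[>] 0)
      (𝓝 (-((‖y‖ ^ n)⁻¹ / sphereVol n) • σ.clifford y φ)) := by
  have hy' : 0 < ‖y‖ := norm_pos_iff.2 hy
  have ht : Tendsto (fun δ : ℝ => δ * ‖y‖) (𝓝[>] 0) (𝓝[>] 0) := by
    refine tendsto_nhdsWithin_iff.2 ⟨?_, ?_⟩
    · have : Tendsto (fun δ : ℝ => δ * ‖y‖) (𝓝 0) (𝓝 (0 * ‖y‖)) := tendsto_id.mul_const _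
      rw [zero_mul] at this
      exact this.mono_left nhdsWithin_le_nhds
    · filter_upwards [self_mem_nhdsWithin] with δ hδ
      exact mul_pos hδ hy'
  have h1 := ((hF.tendsto_deriv.comp ht).const_mul (2 * (‖y‖ ^ n)⁻¹)).smul_const
    (σ.clifford y φ)
  have h2 := ((hF.tendsto_self.comp ht).const_mul (lam * (‖y‖ ^ (n - 1))⁻¹)).smul_const φ
  have h3 := h1.add h2
  rw [mul_zero, zero_smul, add_zero] at h3
  have e : 2 * (‖y‖ ^ n)⁻¹ * -(1 / (2 * sphereVol n)) = -((‖y‖ ^ n)⁻¹ / sphereVol n) := by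
    have := (sphereVol_pos hn).ne'
    field_simp
  rw [e] at h3
  refine h3.congr' ?_
  filter_upwards [self_mem_nhdsWithin] with δ hδ
  have hδ : 0 < δ := hδ
  have hnorm : ‖δ • y‖ = δ * ‖y‖ := by rw [norm_smul, Real.norm_eq_abs, abs_of_pos hδ]
  have hp : ∀ a : ℝ, a ^ n = a ^ (n - 1) * a := fun a => by
    rw [← pow_succ, Nat.sub_add_cancel (Nat.one_le_iff_ne_zero.2 hn)]
  simp only [radialKernel_apply, hnorm, Function.comp_apply, map_smul, _root_.smul_apply,
    smul_add, smul_smul]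
  congr 2
  · rw [mul_pow, hp δ]
    field_simp
  · rw [mul_pow]
    field_simp

/-- The derivative of the cutoff confines `y` to the shell `1 ≤ ‖y‖² ≤ 2`, where the rescaled
kernels are uniformly bounded, so dominated convergence applies. In the limit `y · y · φ = -‖y‖² φ`
leaves a scalar integral equal to `1`. -/
theorem IsRadialProfile.tendsto_integral_rescaled (hn : n ≠ 0) (hF : IsRadialProfile n lam F)
    (σ : SpinorModule n S) (φ : S) {ψ : E n → S} (hψ : Continuous ψ) (hc : HasCompactSupport ψ) :
    Tendsto (fun δ : ℝ => ∫ y, inner ℂ (ψ (δ • y)) ((2 * deriv cutoff (‖y‖ ^ 2)) •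
        σ.clifford y (δ ^ (n - 1) • radialKernel σ lam F (δ • y) φ))) (𝓝[>] 0)
      (𝓝 (inner ℂ (ψ 0) φ)) := by
  obtain ⟨M, hM⟩ := hψ.bounded_above_of_compact_support hc
  have hM0 : 0 ≤ M := (norm_nonneg _).trans (hM 0)
  obtain ⟨N, hN0, hN⟩ := exists_bound_deriv_cutoff
  -- Radius `2` suffices: on the shell `‖y‖ ≤ 2`, and only `δ < 1` matters.
  obtain ⟨C, hC0, hC⟩ := hF.exists_kernel_bound hn σ 2
  have hlim : ∫ y : E n, inner ℂ (ψ 0) ((2 * deriv cutoff (‖y‖ ^ 2)) •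
      σ.clifford y (-((‖y‖ ^ n)⁻¹ / sphereVol n) • σ.clifford y φ)) = inner ℂ (ψ 0) φ := by
    have e : ∀ y : E n, inner ℂ (ψ 0) ((2 * deriv cutoff (‖y‖ ^ 2)) •
        σ.clifford y (-((‖y‖ ^ n)⁻¹ / sphereVol n) • σ.clifford y φ))
        = ((2 * deriv cutoff (‖y‖ ^ 2) * (‖y‖ ^ 2 * (‖y‖ ^ n)⁻¹ / sphereVol n) : ℝ) : ℂ)
          * inner ℂ (ψ 0) φ := by
      intro y
      rw [σ.clifford_real_smul, σ.clifford_sq, ← inner_real_smul_right, smul_neg, neg_smul,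
        neg_neg, smul_smul, smul_smul]
      congr 2
      ring
    simp_rw [e]
    rw [integral_mul_const, integral_complex_ofReal, integral_deriv_cutoff_norm_sq hn]
    simp
  rw [← hlim]
  refine tendsto_integral_filter_of_dominated_convergence
    ((Metric.closedBall 0 2).indicator fun _ => M * (2 * N * (‖σ.cliffordL‖ * 2 * (C * ‖φ‖))))
    ?_ ?_ ?_ ?_
  · filter_upwards [self_mem_nhdsWithin] with δ hδ
    have hδ : 0 < δ := hδ
    have hq : AEStronglyMeasurable (fun y : E n => radialKernel σ lam F (δ • y)) volume :=
      (hF.aestronglyMeasurable_kernel hn σ).comp_quasiMeasurePreserving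
        (Measure.quasiMeasurePreserving_smul volume hδ.ne')
    have hq2 : AEStronglyMeasurable (fun y : E n => δ ^ (n - 1) • radialKernel σ lam F (δ • y) φ)
        volume :=
      ((ContinuousLinearMap.apply ℂ S φ).continuous.comp_aestronglyMeasurable hq).const_smul _
    have hm : AEStronglyMeasurable (fun y : E n =>
        σ.cliffordL y (δ ^ (n - 1) • radialKernel σ lam F (δ • y) φ)) volume :=
      (isBoundedBilinearMap_apply (𝕜 := ℂ) (E := S) (F := S)).continuous.comp_aestronglyMeasurable
        (σ.cliffordL.continuous.aestronglyMeasurable.prodMk hq2)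
    have h1 : Continuous fun y : E n => 2 * deriv cutoff (‖y‖ ^ 2) := by
      have := continuous_deriv_cutoff
      fun_prop
    have h2 : Continuous fun y : E n => ψ (δ • y) := by fun_prop
    exact h2.aestronglyMeasurable.inner (h1.aestronglyMeasurable.smul hm)
  · filter_upwards [Ioo_mem_nhdsGT (zero_lt_one' ℝ)] with δ hδ
    filter_upwards [ae_ne_zero hn] with y hy
    have hy' : 0 < ‖y‖ := norm_pos_iff.2 hy
    rcases lt_or_ge (‖y‖ ^ 2) 1 with h | h
    · rw [deriv_cutoff_of_lt h]
      simp only [mul_zero, zero_smul, inner_zero_right, norm_zero]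
      exact Set.indicator_nonneg (fun _ _ => by positivity) _
    rcases lt_or_ge 2 (‖y‖ ^ 2) with h' | h'
    · rw [deriv_cutoff_of_gt h']
      simp only [mul_zero, zero_smul, inner_zero_right, norm_zero]
      exact Set.indicator_nonneg (fun _ _ => by positivity) _
    have hy1 : 1 ≤ ‖y‖ := by nlinarith
    have hy2 : ‖y‖ ≤ 2 := by nlinarith
    rw [Set.indicator_of_mem (by simpa using hy2)]
    refine (norm_inner_le_norm _ _).trans ?_
    refine mul_le_mul (hM _) ?_ (norm_nonneg _) hM0
    rw [norm_smul, Real.norm_eq_abs, abs_mul, abs_two]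
    refine mul_le_mul (by gcongr; exact hN _) ?_ (norm_nonneg _) (by positivity)
    refine (ContinuousLinearMap.le_opNorm _ _).trans ?_
    refine mul_le_mul ((σ.cliffordL.le_opNorm y).trans (by gcongr)) ?_ (norm_nonneg _)
      (by positivity)
    rw [norm_smul, Real.norm_eq_abs, abs_of_nonneg (by have := hδ.1; positivity)]
    have hnorm : ‖δ • y‖ = δ * ‖y‖ := by rw [norm_smul, Real.norm_eq_abs, abs_of_pos hδ.1]
    have hle := hC (δ • y) (smul_ne_zero hδ.1.ne' hy) (by rw [hnorm]; nlinarith [hδ.1, hδ.2])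
    -- On the shell `1 ≤ ‖y‖`, so `δ ≤ ‖δ • y‖` and the weight can be replaced by the one in the
    -- kernel bound.
    calc δ ^ (n - 1) * ‖radialKernel σ lam F (δ • y) φ‖
        ≤ ‖δ • y‖ ^ (n - 1) * (‖radialKernel σ lam F (δ • y)‖ * ‖φ‖) := by
          have hδ0 := hδ.1.le
          gcongr
          · rw [hnorm]
            exact le_mul_of_one_le_right hδ0 hy1
          · exact ContinuousLinearMap.le_opNorm _ _
      _ ≤ C * ‖φ‖ := by
          rw [← mul_assoc]
          gcongr
  · rw [integrable_indicator_iff measurableSet_closedBall]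
    exact integrableOn_const measure_closedBall_lt_top.ne
  · filter_upwards [ae_ne_zero hn] with y hy
    have h1 : Tendsto (fun δ : ℝ => ψ (δ • y)) (𝓝[>] 0) (𝓝 (ψ 0)) := by
      have hcont : Continuous fun δ : ℝ => ψ (δ • y) := by fun_prop
      have := hcont.tendsto 0
      rw [zero_smul] at this
      exact this.mono_left nhdsWithin_le_nhds
    have h2 := ((σ.clifford y).continuous.tendsto _).comp (hF.tendsto_kernel_smul hn σ φ hy)
    exact h1.inner (h2.const_smul _)

/-- The kernel is a fundamental solution of `D - lam`. -/
theorem IsRadialProfile.integral_inner_kernel (hn : n ≠ 0) (hF : IsRadialProfile n lam F)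
    (σ : SpinorModule n S) (φ : S) {ψ : E n → S} (hψ : ContDiff ℝ 1 ψ)
    (hc : HasCompactSupport ψ) :
    ∫ x, inner ℂ (dirac σ ψ x - lam • ψ x) (radialKernel σ lam F x φ) = inner ℂ (ψ 0) φ := by
  have hg : Continuous fun x => dirac σ ψ x - lam • ψ x :=
    (continuous_dirac σ hψ).sub (hψ.continuous.const_smul lam)
  have hgc : HasCompactSupport fun x => dirac σ ψ x - lam • ψ x :=
    (hasCompactSupport_dirac σ hc).sub (hc.mono fun x hx => by
      rw [Function.mem_support] at hx ⊢
      contrapose! hx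
      simp [hx])
  have hi := hF.integrable_inner_kernel hn σ hg hgc φ
  -- The cutoff has modulus at most `1` and equals `1` at a given `x ≠ 0` once `δ < ‖x‖ / 2`, so
  -- removing it is a dominated limit. The same quantity also tends to `⟨ψ(0), φ⟩`, and limits are
  -- unique.
  have h1 : Tendsto (fun δ : ℝ =>
      ∫ x, inner ℂ (dirac σ ψ x - lam • ψ x) (cutKernel σ lam F φ δ x)) (𝓝[>] 0)
      (𝓝 (∫ x, inner ℂ (dirac σ ψ x - lam • ψ x) (radialKernel σ lam F x φ))) := by
    refine tendsto_integral_filter_of_dominated_convergence _ ?_ ?_ hi.norm ?_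
    · exact Eventually.of_forall fun δ =>
        (hg.inner (hF.contDiff_cutKernel σ φ δ).continuous).aestronglyMeasurable
    · refine Eventually.of_forall fun δ => Eventually.of_forall fun x => ?_
      rw [cutKernel, inner_real_smul_right, norm_mul, Complex.norm_real, Real.norm_eq_abs]
      exact mul_le_of_le_one_left (norm_nonneg _) (abs_cutoff_le _)
    · filter_upwards [ae_ne_zero hn] with x hx
      have hx' : 0 < ‖x‖ := norm_pos_iff.2 hx
      refine tendsto_const_nhds.congr' ?_
      filter_upwards [Ioo_mem_nhdsGT (show (0 : ℝ) < ‖x‖ / 2 by positivity)] with δ hδ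
      have hδ0 := hδ.1
      have hδ1 := hδ.2
      rw [cutKernel, cutoff_of_ge, one_smul]
      rw [le_div_iff₀ (by positivity)]
      nlinarith
  refine tendsto_nhds_unique h1 ((hF.tendsto_integral_rescaled hn σ φ hψ.continuous hc).congr' ?_)
  filter_upwards [self_mem_nhdsWithin] with δ hδ
  exact (hF.integral_cutKernel hn σ φ hψ hc hδ).symm

/-- The translates of the kernel form a Green's function. -/
theorem IsRadialProfile.isGreensFunction (hn : n ≠ 0) (hF : IsRadialProfile n lam F)
    (σ : SpinorModule n S) :
    IsGreensFunction σ lam fun x y => radialKernel σ lam F (x - y) where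
  smooth := (hF.contDiffOn_kernel σ).comp (contDiff_fst.sub contDiff_snd).contDiffOn
    fun _ hq => sub_ne_zero.2 hq
  locallyIntegrable := hF.locallyIntegrable_kernel_sub hn σ
  tendsto_integral := by
    intro p φ ψ hψ hc
    have : NeZero n := ⟨hn⟩
    have hψ1 : ContDiff ℝ 1 ψ := hψ.of_le (by simp)
    -- Translating the test spinor moves the pole `p` to the origin.
    have hτ : ContDiff ℝ 1 fun x => ψ (x + p) := hψ1.comp (contDiff_id.add contDiff_const)
    have hτc : HasCompactSupport fun x => ψ (x + p) :=
      hc.comp_homeomorph (Homeomorph.addRight p)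
    have hg : Continuous fun x => dirac σ (fun x => ψ (x + p)) x - lam • ψ (x + p) :=
      (continuous_dirac σ hτ).sub (hτ.continuous.const_smul lam)
    have hgc : HasCompactSupport fun x => dirac σ (fun x => ψ (x + p)) x - lam • ψ (x + p) :=
      (hasCompactSupport_dirac σ hτc).sub (hτc.mono fun x hx => by
        rw [Function.mem_support] at hx ⊢
        contrapose! hx
        simp [hx])
    have hi := (hF.integrable_inner_kernel hn σ hg hgc φ).comp_sub_right p
    have hv := hF.integral_inner_kernel hn σ φ hτ hτc
    rw [← integral_sub_right_eq_self _ p] at hv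
    simp only [dirac_comp_add_right, sub_add_cancel, zero_add] at hi hv
    rw [← hv]
    -- The complements of the balls exhaust `ℝⁿ` up to the null set `{p}`, and the integrand is
    -- absolutely integrable, so the truncated integrals converge to the full one.
    refine AECover.integral_tendsto_of_countably_generated ⟨?_, ?_⟩ hi
    · filter_upwards [Measure.ae_ne volume p] with x hx
      have hx' : 0 < dist x p := dist_pos.2 hx
      filter_upwards [Ioo_mem_nhdsGT hx'] with ε hε
      simpa using hε.2.le
    · exact fun ε => measurableSet_ball.compl

end Kernel

/-! ### Entire power series on the real line -/

/-- Coefficients of an entire power series of exponential type. -/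
def IsEntireCoeff (a : ℕ → ℝ) : Prop := ∃ C M : ℝ, ∀ k, |a k| ≤ C * (M ^ k / k.factorial)

/-- The sum of a power series. -/
def ser (a : ℕ → ℝ) (s : ℝ) : ℝ := ∑' k, a k * s ^ k

/-- The coefficients of the derivative of a power series. -/
def shiftCoeff (a : ℕ → ℝ) (k : ℕ) : ℝ := (k + 1) * a (k + 1)

theorem IsEntireCoeff.summable_norm {a : ℕ → ℝ} (ha : IsEntireCoeff a) (s : ℝ) :
    Summable fun k => |a k| * |s| ^ k := by
  obtain ⟨C, M, h⟩ := ha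
  refine Summable.of_nonneg_of_le (fun k => by positivity) (fun k => ?_)
    ((Real.summable_pow_div_factorial (M * |s|)).mul_left C)
  calc |a k| * |s| ^ k ≤ C * (M ^ k / k.factorial) * |s| ^ k := by gcongr; exact h k
    _ = C * ((M * |s|) ^ k / k.factorial) := by rw [mul_pow]; ring

theorem IsEntireCoeff.summable {a : ℕ → ℝ} (ha : IsEntireCoeff a) (s : ℝ) :
    Summable fun k => a k * s ^ k := by
  refine Summable.of_norm ?_
  simpa [abs_mul, abs_pow] using ha.summable_norm s

theorem IsEntireCoeff.shift {a : ℕ → ℝ} (ha : IsEntireCoeff a) : IsEntireCoeff (shiftCoeff a) := by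
  obtain ⟨C, M, h⟩ := ha
  refine ⟨C * M, M, fun k => ?_⟩
  rw [shiftCoeff, abs_mul, abs_of_nonneg (by positivity)]
  calc ((k : ℝ) + 1) * |a (k + 1)| ≤ (k + 1) * (C * (M ^ (k + 1) / (k + 1).factorial)) := by
        gcongr
        exact h _
    _ = C * M * (M ^ k / k.factorial) := by
        rw [Nat.factorial_succ, pow_succ]
        push_cast
        field_simp

theorem IsEntireCoeff.const_mul {a : ℕ → ℝ} (ha : IsEntireCoeff a) (x : ℝ) :
    IsEntireCoeff fun k => x * a k := by
  obtain ⟨C, M, h⟩ := ha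
  refine ⟨|x| * C, M, fun k => ?_⟩
  rw [abs_mul, mul_assoc]
  gcongr
  exact h k

theorem IsEntireCoeff.add {a b : ℕ → ℝ} (ha : IsEntireCoeff a) (hb : IsEntireCoeff b) :
    IsEntireCoeff fun k => a k + b k := by
  obtain ⟨C, M, h⟩ := ha
  obtain ⟨C', M', h'⟩ := hb
  refine ⟨|C| + |C'|, max |M| |M'|, fun k => (abs_add_le _ _).trans ?_⟩
  rw [add_mul]
  gcongr
  · refine (h k).trans ((le_abs_self _).trans ?_)
    rw [abs_mul, abs_div, abs_pow, Nat.abs_cast]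
    gcongr
    exact le_max_left _ _
  · refine (h' k).trans ((le_abs_self _).trans ?_)
    rw [abs_mul, abs_div, abs_pow, Nat.abs_cast]
    gcongr
    exact le_max_right _ _

theorem isEntireCoeff_zero : IsEntireCoeff fun _ => 0 := ⟨0, 0, fun k => by simp⟩

theorem isEntireCoeff_const (x : ℝ) : IsEntireCoeff fun k => if k = 0 then x else 0 :=
  ⟨|x|, 0, fun k => by by_cases h : k = 0 <;> simp [h]⟩

/-- Iterating the ratio bound gives `|a k| ≤ |a 0| M^k / k!`; this is how two-term recurrences yield
entire series. -/
theorem isEntireCoeff_of_ratio {a : ℕ → ℝ} {M : ℝ} (hM : 0 ≤ M)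
    (h : ∀ k : ℕ, (k + 1) * |a (k + 1)| ≤ M * |a k|) : IsEntireCoeff a := by
  refine ⟨|a 0|, M, fun k => ?_⟩
  induction k with
  | zero => simp
  | succ k ih =>
    have h1 : (0 : ℝ) < k + 1 := by positivity
    have h2 : |a (k + 1)| ≤ M * |a k| / (k + 1) := by
      rw [le_div_iff₀ h1, mul_comm]
      exact h k
    refine h2.trans ?_
    calc M * |a k| / (k + 1) ≤ M * (|a 0| * (M ^ k / k.factorial)) / (k + 1) := by gcongr
      _ = |a 0| * (M ^ (k + 1) / (k + 1).factorial) := by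
        rw [Nat.factorial_succ, pow_succ]
        push_cast
        field_simp

theorem ser_zero (a : ℕ → ℝ) : ser a 0 = a 0 := by
  rw [ser, tsum_eq_single 0 fun k hk => by simp [hk]]
  simp

theorem ser_zero_coeff (s : ℝ) : ser (fun _ => 0) s = 0 := by simp [ser]

theorem ser_const_coeff (x s : ℝ) : ser (fun k => if k = 0 then x else 0) s = x := by
  rw [ser, tsum_eq_single 0 fun k hk => by simp [hk]]
  simp

theorem ser_const_mul (x : ℝ) (a : ℕ → ℝ) (s : ℝ) : ser (fun k => x * a k) s = x * ser a s := by
  simp only [ser, mul_assoc, tsum_mul_left]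

theorem ser_add {a b : ℕ → ℝ} (ha : IsEntireCoeff a) (hb : IsEntireCoeff b) (s : ℝ) :
    ser (fun k => a k + b k) s = ser a s + ser b s := by
  simp only [ser, add_mul]
  exact (ha.summable s).tsum_add (hb.summable s)

theorem ser_eq_add_mul {a : ℕ → ℝ} (ha : IsEntireCoeff a) (s : ℝ) :
    ser a s = a 0 + s * ser (fun k => a (k + 1)) s := by
  rw [ser, (ha.summable s).tsum_eq_zero_add, ser, ← tsum_mul_left]
  simp only [pow_zero, mul_one, pow_succ]
  congr 2
  ext k
  ring

theorem mul_ser_shift {a : ℕ → ℝ} (ha : IsEntireCoeff a) (s : ℝ) :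
    s * ser (shiftCoeff a) s = ser (fun k => k * a k) s := by
  have h : Summable fun k : ℕ => (k : ℝ) * a k * s ^ k := by
    rw [← summable_nat_add_iff 1]
    refine ((ha.shift.summable s).mul_left s).congr fun k => ?_
    rw [shiftCoeff]
    push_cast
    ring
  rw [ser, ser, h.tsum_eq_zero_add, ← tsum_mul_left]
  simp only [Nat.cast_zero, zero_mul, zero_add]
  congr 1
  ext k
  rw [shiftCoeff]
  push_cast
  ring

/-- Termwise differentiation on the ball of radius `|s| + 1`, where the differentiated series has a
summable majorant. -/
theorem hasDerivAt_ser {a : ℕ → ℝ} (ha : IsEntireCoeff a) (s : ℝ) :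
    HasDerivAt (ser a) (ser (shiftCoeff a) s) s := by
  have hd : ∀ (k : ℕ) (y : ℝ), HasDerivAt (fun y => a k * y ^ k) (a k * (k * y ^ (k - 1))) y :=
    fun k y => (hasDerivAt_pow k y).const_mul _
  have hu : Summable fun k : ℕ => |a k| * (k * (|s| + 1) ^ (k - 1)) := by
    rw [← summable_nat_add_iff 1]
    refine (ha.shift.summable_norm (|s| + 1)).congr fun k => ?_
    have h1 : 0 ≤ (k : ℝ) + 1 := by positivity
    have h2 : 0 ≤ |s| + 1 := by positivity
    rw [shiftCoeff, abs_mul, abs_of_nonneg h1, abs_of_nonneg h2, Nat.add_sub_cancel]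
    push_cast
    ring
  have h := hasDerivAt_tsum_of_isPreconnected hu (Metric.isOpen_ball (x := (0 : ℝ)) (ε := |s| + 1))
    (convex_ball _ _).isPreconnected (fun k y _ => hd k y) (fun k y hy => ?_)
    (Metric.mem_ball_self (by positivity)) (ha.summable 0)
    (y := s) (by simp)
  · refine h.congr_deriv ?_
    have hs : Summable fun k : ℕ => a k * (k * s ^ (k - 1)) := by
      rw [← summable_nat_add_iff 1]
      refine (ha.shift.summable s).congr fun k => ?_
      rw [shiftCoeff, Nat.add_sub_cancel]
      push_cast
      ring
    rw [hs.tsum_eq_zero_add, ser]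
    simp only [Nat.cast_zero, zero_mul, mul_zero, zero_add, Nat.add_sub_cancel]
    congr 1
    ext k
    rw [shiftCoeff]
    push_cast
    ring
  · have hy' : |y| ≤ |s| + 1 := by simpa using (Metric.mem_ball.1 hy).le
    rw [Real.norm_eq_abs, abs_mul, abs_mul, abs_pow, Nat.abs_cast]
    gcongr

theorem continuous_ser {a : ℕ → ℝ} (ha : IsEntireCoeff a) : Continuous (ser a) :=
  continuous_iff_continuousAt.2 fun s => (hasDerivAt_ser ha s).continuousAt

theorem contDiff_ser {a : ℕ → ℝ} (ha : IsEntireCoeff a) : ContDiff ℝ ∞ (ser a) := by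
  rw [contDiff_infty]
  intro k
  induction k generalizing a with
  | zero => exact contDiff_zero.2 (continuous_ser ha)
  | succ k ih =>
    have hd : deriv (ser a) = ser (shiftCoeff a) := funext fun s => (hasDerivAt_ser ha s).deriv
    have h : ContDiff ℝ ((k : WithTop ℕ∞) + 1) (ser a) :=
      contDiff_succ_iff_deriv.2 ⟨fun s => (hasDerivAt_ser ha s).differentiableAt,
        by simp, by rw [hd]; exact ih ha.shift⟩
    exact_mod_cast h

/-- The operator `s ∂² + ν ∂ + μ` sends power series to power series, so an equation for the sum
becomes a two-term recurrence for the coefficients. -/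
theorem ser_bessel_operator {a : ℕ → ℝ} (ha : IsEntireCoeff a) (ν μ s : ℝ) :
    s * ser (shiftCoeff (shiftCoeff a)) s + ν * ser (shiftCoeff a) s + μ * ser a s
      = ser (fun k => (k + 1) * (k + ν) * a (k + 1) + μ * a k) s := by
  have h1 : Summable fun k : ℕ => (k : ℝ) * shiftCoeff a k * s ^ k := by
    rw [← summable_nat_add_iff 1]
    refine ((ha.shift.shift.summable s).mul_left s).congr fun k => ?_
    rw [shiftCoeff]
    push_cast
    ring
  rw [mul_ser_shift ha.shift, ser, ser, ser, ← tsum_mul_left, ← tsum_mul_left,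
    ← h1.tsum_add ((ha.shift.summable s).mul_left ν),
    ← (h1.add ((ha.shift.summable s).mul_left ν)).tsum_add ((ha.summable s).mul_left μ), ser]
  congr 1
  ext k
  rw [shiftCoeff]
  ring

/-! ### Frobenius expansions of radial profiles -/

/-- A function given by a Frobenius expansion. -/
def frobenius (m : ℝ) (a b c : ℕ → ℝ) (s : ℝ) : ℝ :=
  s ^ (-m) * ser a s + Real.log s * ser b s + ser c s

section Frobenius

variable {m : ℝ} {a b c : ℕ → ℝ}

theorem hasDerivAt_frobenius (ha : IsEntireCoeff a) (hb : IsEntireCoeff b) (hc : IsEntireCoeff c)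
    {s : ℝ} (hs : 0 < s) :
    HasDerivAt (frobenius m a b c) (-m * s ^ (-m - 1) * ser a s + s ^ (-m) * ser (shiftCoeff a) s
      + (s⁻¹ * ser b s + Real.log s * ser (shiftCoeff b) s) + ser (shiftCoeff c) s) s :=
  (((Real.hasDerivAt_rpow_const (Or.inl hs.ne')).mul (hasDerivAt_ser ha s)).add
    ((Real.hasDerivAt_log hs.ne').mul (hasDerivAt_ser hb s))).add (hasDerivAt_ser hc s)

theorem deriv_frobenius (ha : IsEntireCoeff a) (hb : IsEntireCoeff b) (hc : IsEntireCoeff c)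
    {s : ℝ} (hs : 0 < s) :
    deriv (frobenius m a b c) s = -m * s ^ (-m - 1) * ser a s + s ^ (-m) * ser (shiftCoeff a) s
      + (s⁻¹ * ser b s + Real.log s * ser (shiftCoeff b) s) + ser (shiftCoeff c) s :=
  (hasDerivAt_frobenius ha hb hc hs).deriv

theorem deriv_deriv_frobenius (ha : IsEntireCoeff a) (hb : IsEntireCoeff b)
    (hc : IsEntireCoeff c) {s : ℝ} (hs : 0 < s) :
    deriv (deriv (frobenius m a b c)) s
      = -m * ((-m - 1) * s ^ (-m - 1 - 1)) * ser a s
        + -m * s ^ (-m - 1) * ser (shiftCoeff a) s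
        + (-m * s ^ (-m - 1) * ser (shiftCoeff a) s
          + s ^ (-m) * ser (shiftCoeff (shiftCoeff a)) s)
        + ((-(s ^ 2)⁻¹ * ser b s + s⁻¹ * ser (shiftCoeff b) s)
          + (s⁻¹ * ser (shiftCoeff b) s + Real.log s * ser (shiftCoeff (shiftCoeff b)) s))
        + ser (shiftCoeff (shiftCoeff c)) s := by
  have h : deriv (frobenius m a b c) =ᶠ[𝓝 s] fun s =>
      -m * s ^ (-m - 1) * ser a s + s ^ (-m) * ser (shiftCoeff a) s
      + (s⁻¹ * ser b s + Real.log s * ser (shiftCoeff b) s) + ser (shiftCoeff c) s := by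
    filter_upwards [Ioi_mem_nhds hs] with t ht
    exact deriv_frobenius ha hb hc ht
  rw [h.deriv_eq]
  exact (((((Real.hasDerivAt_rpow_const (Or.inl hs.ne')).const_mul (-m)).mul
    (hasDerivAt_ser ha s)).add ((Real.hasDerivAt_rpow_const (Or.inl hs.ne')).mul
    (hasDerivAt_ser ha.shift s))).add (((hasDerivAt_inv hs.ne').mul (hasDerivAt_ser hb s)).add
    ((Real.hasDerivAt_log hs.ne').mul (hasDerivAt_ser hb.shift s)))).add
    (hasDerivAt_ser hc.shift s) |>.deriv

theorem contDiffOn_frobenius (ha : IsEntireCoeff a) (hb : IsEntireCoeff b)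
    (hc : IsEntireCoeff c) : ContDiffOn ℝ ∞ (frobenius m a b c) (Set.Ioi 0) := by
  intro s hs
  have hs' : s ≠ 0 := ne_of_gt hs
  exact ((((Real.contDiffAt_rpow_const_of_ne hs').mul (contDiff_ser ha).contDiffAt).add
    ((Real.contDiffAt_log.2 hs').mul (contDiff_ser hb).contDiffAt)).add
    (contDiff_ser hc).contDiffAt).contDiffWithinAt

/-- The Bessel equation for a Frobenius expansion, in terms of its coefficients. -/
theorem frobenius_ode {μ : ℝ} (ha : IsEntireCoeff a) (hb : IsEntireCoeff b)
    (hc : IsEntireCoeff c)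
    (hrb : ∀ k : ℕ, (k + 1) * (k + (m + 1)) * b (k + 1) + μ * b k = 0)
    (hrc : ∀ k : ℕ, (k + 1) * (k + (m + 1)) * c (k + 1) + μ * c k
      + (2 * (k + 1) + m) * b (k + 1) = 0)
    -- Conjugation by `s^(-m)` turns the parameter `m + 1` of the operator into `1 - m`. Applying
    -- the operator to `log s · B` leaves `2 B' + m B / s` besides the logarithmic term. Its regular
    -- part enters the recurrence for `c`, but the pole `m b₀ / s` must be cancelled by the `s^(-m)`
    -- part. This condition compares functions because the power `s^(-m)` need not be integral.
    (hra : ∀ s, 0 < s → s ^ (-m) * ser (fun k => (k + 1) * (k + (1 - m)) * a (k + 1) + μ * a k) s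
      + m * b 0 / s = 0) {s : ℝ} (hs : 0 < s) :
    s * deriv (deriv (frobenius m a b c)) s + (m + 1) * deriv (frobenius m a b c) s
      + μ * frobenius m a b c s = 0 := by
  have e1 := ser_bessel_operator ha (1 - m) μ s
  have e2 := ser_bessel_operator hb (m + 1) μ s
  have e3 := ser_bessel_operator hc (m + 1) μ s
  have z2 : ser (fun k => (k + 1) * (k + (m + 1)) * b (k + 1) + μ * b k) s = 0 := by
    simp only [hrb, ser_zero_coeff]
  have z3 : ser (fun k => (k + 1) * (k + (m + 1)) * c (k + 1) + μ * c k) s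
      = -(2 * ser (shiftCoeff b) s + m * ser (fun k => b (k + 1)) s) := by
    have hb1 : Summable fun k => b (k + 1) * s ^ k := by
      have h := (summable_nat_add_iff 1).2 (hb.summable s)
      refine (h.mul_left s⁻¹).congr fun k => ?_
      rw [pow_succ]
      field_simp
    rw [ser, ser, ser, ← tsum_mul_left, ← tsum_mul_left,
      ← ((hb.shift.summable s).mul_left 2).tsum_add (hb1.mul_left m), ← tsum_neg]
    refine tsum_congr fun k => ?_
    rw [shiftCoeff]
    linear_combination s ^ k * hrc k
  have hb0 := ser_eq_add_mul hb s
  have p1 : s ^ (-m - 1) = s ^ (-m) / s := Real.rpow_sub_one hs.ne' _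
  have p2 : s ^ (-m - 1 - 1) = s ^ (-m) / s / s := by rw [Real.rpow_sub_one hs.ne', p1]
  have ea := hra s hs
  rw [← e1] at ea
  rw [z2] at e2
  rw [z3] at e3
  rw [deriv_deriv_frobenius ha hb hc hs, deriv_frobenius ha hb hc hs, frobenius, p1, p2]
  have hsb : s⁻¹ * ser b s = b 0 / s + ser (fun k => b (k + 1)) s := by
    rw [hb0]
    field_simp
  have i1 : s * s⁻¹ = 1 := mul_inv_cancel₀ hs.ne'
  have i2 : s * (s ^ 2)⁻¹ = s⁻¹ := by field_simp
  have i3 : s * (s ^ (-m) / s / s) = s ^ (-m) / s := by field_simp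
  have i4 : s * (s ^ (-m) / s) = s ^ (-m) := by field_simp
  linear_combination ea + Real.log s * e2 + e3 + m * hsb + 2 * ser (shiftCoeff b) s * i1
    - ser b s * i2 + m * (m + 1) * ser a s * i3 - 2 * m * ser (shiftCoeff a) s * i4

end Frobenius

/-! ### Behaviour of Frobenius expansions at the origin -/

theorem tendsto_rpow_nhdsGT_zero {p : ℝ} (hp : 0 < p) :
    Tendsto (fun s : ℝ => s ^ p) (𝓝[>] 0) (𝓝 0) := by
  have h := (Real.continuousAt_rpow_const (0 : ℝ) p (Or.inr hp.le)).tendsto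
  rw [Real.zero_rpow hp.ne'] at h
  exact h.mono_left nhdsWithin_le_nhds

theorem IsEntireCoeff.tendsto_ser {a : ℕ → ℝ} (ha : IsEntireCoeff a) :
    Tendsto (ser a) (𝓝[>] 0) (𝓝 (a 0)) := by
  have h := (continuous_ser ha).tendsto 0
  rw [ser_zero] at h
  exact h.mono_left nhdsWithin_le_nhds

theorem tendsto_sq_nhdsGT_zero : Tendsto (fun r : ℝ => r ^ 2) (𝓝[>] 0) (𝓝[>] 0) := by
  refine tendsto_nhdsWithin_iff.2 ⟨?_, ?_⟩
  · have h := (continuous_pow (M := ℝ) 2).tendsto 0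
    rw [zero_pow two_ne_zero] at h
    exact h.mono_left nhdsWithin_le_nhds
  · filter_upwards [self_mem_nhdsWithin] with r hr
    exact pow_pos (Set.mem_Ioi.1 hr) 2

theorem pow_eq_sq_rpow {r : ℝ} (hr : 0 < r) (n : ℕ) : r ^ n = (r ^ 2) ^ ((n : ℝ) / 2) := by
  rw [← Real.rpow_natCast r 2, ← Real.rpow_mul hr.le, ← Real.rpow_natCast r n]
  congr 1
  push_cast
  ring

section Frobenius

variable {m : ℝ} {a b c : ℕ → ℝ}

/-- For `m > 0` the leading singularity of the derivative is that of `a₀ s^(-m)`, the logarithm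
being of lower order. For `m = 0` the power is regular and the leading term is `b₀ / s`. -/
theorem tendsto_rpow_mul_deriv_frobenius (ha : IsEntireCoeff a) (hb : IsEntireCoeff b)
    (hc : IsEntireCoeff c) (hm : 0 ≤ m) :
    Tendsto (fun s => s ^ (m + 1) * deriv (frobenius m a b c) s) (𝓝[>] 0)
      (𝓝 (-(m * a 0) + if m = 0 then b 0 else 0)) := by
  have hm1 : 0 < m + 1 := by linarith
  have h1 : Tendsto (fun s : ℝ => s) (𝓝[>] 0) (𝓝 0) :=
    tendsto_id.mono_left nhdsWithin_le_nhds
  have h2 : Tendsto (fun s : ℝ => s ^ m * ser b s) (𝓝[>] 0) (𝓝 (if m = 0 then b 0 else 0)) := by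
    split_ifs with h
    · simpa [h] using hb.tendsto_ser
    · simpa using (tendsto_rpow_nhdsGT_zero (lt_of_le_of_ne hm (Ne.symm h))).mul hb.tendsto_ser
  have h3 := (tendsto_log_mul_rpow_nhdsGT_zero hm1).mul hb.shift.tendsto_ser
  have h4 := (tendsto_rpow_nhdsGT_zero hm1).mul hc.shift.tendsto_ser
  have h5 := (((((ha.tendsto_ser.const_mul m).neg).add (h1.mul ha.shift.tendsto_ser)).add
    h2).add h3).add h4
  simp only [zero_mul, add_zero] at h5
  refine h5.congr' ?_
  filter_upwards [self_mem_nhdsWithin] with s hs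
  have hs : 0 < s := hs
  rw [deriv_frobenius ha hb hc hs, Real.rpow_sub_one hs.ne', Real.rpow_neg hs.le,
    Real.rpow_add_one hs.ne']
  have := (Real.rpow_pos_of_pos hs m).ne'
  field_simp
  ring

theorem tendsto_rpow_mul_frobenius (ha : IsEntireCoeff a) (hb : IsEntireCoeff b)
    (hc : IsEntireCoeff c) (hm : 0 ≤ m) :
    Tendsto (fun s => s ^ (m + 1 / 2) * frobenius m a b c s) (𝓝[>] 0) (𝓝 0) := by
  have hm1 : 0 < m + 1 / 2 := by linarith
  have h1 := (tendsto_rpow_nhdsGT_zero (p := 1 / 2) (by norm_num)).mul ha.tendsto_ser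
  have h2 := (tendsto_log_mul_rpow_nhdsGT_zero hm1).mul hb.tendsto_ser
  have h3 := (tendsto_rpow_nhdsGT_zero hm1).mul hc.tendsto_ser
  have h4 := (h1.add h2).add h3
  simp only [zero_mul, add_zero] at h4
  refine h4.congr' ?_
  filter_upwards [self_mem_nhdsWithin] with s hs
  have hs : 0 < s := hs
  rw [frobenius, Real.rpow_neg hs.le, Real.rpow_add hs]
  have := (Real.rpow_pos_of_pos hs m).ne'
  field_simp

/-- A Frobenius expansion satisfying the recurrences for the Bessel equation, with the right
leading coefficient, is a radial profile. -/
theorem isRadialProfile_frobenius {n : ℕ} (hn : 2 ≤ n) (hmn : m = ((n : ℝ) - 2) / 2) {lam : ℝ}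
    (ha : IsEntireCoeff a) (hb : IsEntireCoeff b) (hc : IsEntireCoeff c)
    (hrb : ∀ k : ℕ, (k + 1) * (k + (m + 1)) * b (k + 1) + lam ^ 2 / 4 * b k = 0)
    (hrc : ∀ k : ℕ, (k + 1) * (k + (m + 1)) * c (k + 1) + lam ^ 2 / 4 * c k
      + (2 * (k + 1) + m) * b (k + 1) = 0)
    (hra : ∀ s, 0 < s →
      s ^ (-m) * ser (fun k => (k + 1) * (k + (1 - m)) * a (k + 1) + lam ^ 2 / 4 * a k) s
        + m * b 0 / s = 0)
    -- The flux normalisation: it fixes `a 0` when `n ≥ 3` and `b 0` when `n = 2`.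
    (h0 : -(m * a 0) + (if m = 0 then b 0 else 0) = -(1 / (2 * sphereVol n))) :
    IsRadialProfile n lam (frobenius m a b c) := by
  have hn' : (2 : ℝ) ≤ n := by exact_mod_cast hn
  have hm : 0 ≤ m := by linarith
  refine ⟨contDiffOn_frobenius ha hb hc, fun s hs => ?_, ?_, ?_⟩
  · have h := frobenius_ode ha hb hc hrb hrc hra hs
    have hnm : (n : ℝ) = 2 * m + 2 := by linarith
    rw [hnm]
    linear_combination 4 * h
  · rw [← h0]
    refine ((tendsto_rpow_mul_deriv_frobenius ha hb hc hm).comp tendsto_sq_nhdsGT_zero).congr' ?_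
    filter_upwards [self_mem_nhdsWithin] with r hr
    have e : m + 1 = (n : ℝ) / 2 := by linarith
    rw [Function.comp_apply, pow_eq_sq_rpow hr n, e]
  · refine ((tendsto_rpow_mul_frobenius ha hb hc hm).comp tendsto_sq_nhdsGT_zero).congr' ?_
    filter_upwards [self_mem_nhdsWithin] with r hr
    have e : m + 1 / 2 = ((n - 1 : ℕ) : ℝ) / 2 := by
      rw [Nat.cast_sub (by omega)]
      push_cast
      linarith
    rw [Function.comp_apply, pow_eq_sq_rpow hr (n - 1), e]

end Frobenius

/-! ### Bessel functions as power series -/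

/-- The coefficients of the power series in `s` of `(√μ)^(-ν) s^(-ν/2) J_ν(2 √(μ s))`. -/
def besselCoeff (ν μ : ℝ) (k : ℕ) : ℝ :=
  (-μ) ^ k / ((k.factorial : ℝ) * Real.Gamma (ν + k + 1))

theorem besselJ_mul_eq (ν lam r : ℝ) :
    besselJ ν (|lam| * r) = (|lam| / 2 * r) ^ ν * ser (besselCoeff ν (lam ^ 2 / 4)) (r ^ 2) := by
  have h1 : |lam| * r / 2 = |lam| / 2 * r := by ring
  rw [besselJ, ser, h1]
  congr 1
  refine tsum_congr fun k => ?_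
  have h2 : -((|lam| * r) ^ 2 / 4) = -(lam ^ 2 / 4) * r ^ 2 := by
    rw [mul_pow, sq_abs]
    ring
  rw [h2, besselCoeff, mul_pow]
  ring

theorem besselCoeff_succ {ν μ : ℝ} {k : ℕ} (h : ν + k + 1 ≠ 0) :
    (k + 1) * (k + (ν + 1)) * besselCoeff ν μ (k + 1) + μ * besselCoeff ν μ k = 0 := by
  have hg : Real.Gamma (ν + (k + 1 : ℕ) + 1) = (ν + k + 1) * Real.Gamma (ν + k + 1) := by
    rw [← Real.Gamma_add_one h]
    congr 1
    push_cast
    ring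
  have hk : (k : ℝ) + (ν + 1) = ν + k + 1 := by ring
  rw [besselCoeff, besselCoeff, hg, Nat.factorial_succ, hk, pow_succ]
  push_cast
  -- At a pole `Real.Gamma` takes the value `0`; both coefficients are then `0` and the recurrence
  -- holds trivially.
  by_cases h0 : Real.Gamma (ν + k + 1) = 0
  · simp [h0]
  · field_simp
    ring

/-- Staying at distance `1/2` from the zeros of `ν + k + 1` bounds the ratio of consecutive
coefficients. This covers the orders needed: natural numbers and negative half-integers. -/
theorem isEntireCoeff_besselCoeff {ν μ : ℝ} (h : ∀ k : ℕ, 1 / 2 ≤ |ν + k + 1|) :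
    IsEntireCoeff (besselCoeff ν μ) := by
  refine isEntireCoeff_of_ratio (M := 2 * |μ|) (by positivity) fun k => ?_
  have hk : ν + k + 1 ≠ 0 := by
    intro h0
    have := h k
    rw [h0, abs_zero] at this
    norm_num at this
  have e := besselCoeff_succ (μ := μ) hk
  have e2 : ((k : ℝ) + 1) * (ν + k + 1) * besselCoeff ν μ (k + 1) = -(μ * besselCoeff ν μ k) := by
    linear_combination e
  have e3 := congrArg abs e2
  rw [abs_mul, abs_mul, abs_neg, abs_mul, abs_of_nonneg (by positivity : (0 : ℝ) ≤ k + 1)] at e3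
  have h1 : 0 ≤ ((k : ℝ) + 1) * |besselCoeff ν μ (k + 1)| := by positivity
  nlinarith [h k]

theorem isEntireCoeff_besselCoeff_nat (j : ℕ) (μ : ℝ) : IsEntireCoeff (besselCoeff j μ) := by
  refine isEntireCoeff_besselCoeff fun k => ?_
  rw [abs_of_nonneg (by positivity)]
  have : (0 : ℝ) ≤ j + k := by positivity
  linarith

theorem besselCoeff_nat (j : ℕ) (μ : ℝ) (k : ℕ) :
    besselCoeff j μ k = (-μ) ^ k / ((k.factorial : ℝ) * ((j + k).factorial : ℝ)) := by
  rw [besselCoeff, ← Real.Gamma_nat_eq_factorial (j + k)]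
  push_cast
  rfl

/-- The coefficients of the finite singular part of `Y_j`. -/
def besselPolarCoeff (j : ℕ) (μ : ℝ) (k : ℕ) : ℝ :=
  if k < j then ((j - k - 1).factorial : ℝ) / (k.factorial : ℝ) * μ ^ k else 0

/-- The coefficients of the digamma series of `Y_j`. -/
def besselDigammaCoeff (j : ℕ) (μ : ℝ) (k : ℕ) : ℝ :=
  (digammaSucc k + digammaSucc (j + k)) * besselCoeff j μ k

theorem isEntireCoeff_besselPolarCoeff (j : ℕ) {μ : ℝ} (hμ : 0 ≤ μ) :
    IsEntireCoeff (besselPolarCoeff j μ) := by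
  refine ⟨j.factorial, μ, fun k => ?_⟩
  rw [besselPolarCoeff]
  split_ifs with h
  · rw [abs_of_nonneg (by positivity), div_mul_eq_mul_div, ← mul_div_assoc]
    gcongr
    omega
  · rw [abs_zero]
    positivity

theorem harmonic_nonneg_le (k : ℕ) : (0 : ℝ) ≤ harmonic k ∧ (harmonic k : ℝ) ≤ k := by
  induction k with
  | zero => simp
  | succ k ih =>
    have h1 : ((k : ℝ) + 1)⁻¹ ≤ 1 := inv_le_one_of_one_le₀ (by linarith [k.cast_nonneg (α := ℝ)])
    have h2 : (0 : ℝ) ≤ ((k : ℝ) + 1)⁻¹ := by positivity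
    rw [harmonic_succ]
    push_cast
    constructor <;> linarith [ih.1, ih.2]

theorem digammaSucc_succ (k : ℕ) : digammaSucc (k + 1) = digammaSucc k + ((k : ℝ) + 1)⁻¹ := by
  rw [digammaSucc, digammaSucc, harmonic_succ]
  push_cast
  ring

theorem isEntireCoeff_besselDigammaCoeff (j : ℕ) (μ : ℝ) :
    IsEntireCoeff (besselDigammaCoeff j μ) := by
  obtain ⟨C, M, h⟩ := isEntireCoeff_besselCoeff_nat j μ
  -- Harmonic numbers satisfy `H_k ≤ k`, so the digamma factor grows at most linearly; `k + 1 ≤ 2^k`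
  -- absorbs this growth by doubling `M`.
  refine ⟨(2 + j + 2 * |Real.eulerMascheroniConstant|) * C, 2 * M, fun k => ?_⟩
  have hd : |digammaSucc k + digammaSucc (j + k)|
      ≤ (2 + j + 2 * |Real.eulerMascheroniConstant|) * 2 ^ k := by
    have h1 := harmonic_nonneg_le k
    have h2 := harmonic_nonneg_le (j + k)
    push_cast at h2
    have h3 := abs_le.1 (le_refl |Real.eulerMascheroniConstant|)
    have h4 : (k : ℝ) + 1 ≤ 2 ^ k := by exact_mod_cast Nat.lt_two_pow_self (n := k)
    have h5 : (0 : ℝ) ≤ j := by positivity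
    have h6 : (0 : ℝ) ≤ k := by positivity
    refine le_trans (b := (2 + j + 2 * |Real.eulerMascheroniConstant|) * (k + 1)) ?_
      (by gcongr)
    rw [digammaSucc, digammaSucc, abs_le]
    constructor <;> nlinarith [h1.1, h1.2, h2.1, h2.2, h3.1, h3.2, mul_nonneg h5 h6,
      mul_nonneg (abs_nonneg Real.eulerMascheroniConstant) h6]
  rw [besselDigammaCoeff, abs_mul]
  calc _ ≤ (2 + j + 2 * |Real.eulerMascheroniConstant|) * 2 ^ k * (C * (M ^ k / k.factorial)) :=
        mul_le_mul hd (h k) (abs_nonneg _) (by positivity)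
    _ = _ := by
        rw [mul_pow]
        ring

/-- The digamma increments are `1/(k+1)` and `1/(j+k+1)`. Multiplied by `(k+1)(k+j+1)`, they add up
to `2(k+1) + j`, the forcing produced by the logarithmic term. -/
theorem besselDigammaCoeff_succ (j : ℕ) (μ : ℝ) (k : ℕ) :
    (k + 1) * (k + ((j : ℝ) + 1)) * besselDigammaCoeff j μ (k + 1) + μ * besselDigammaCoeff j μ k
      = (2 * (k + 1) + j) * besselCoeff j μ (k + 1) := by
  have h := besselCoeff_succ (ν := j) (μ := μ) (k := k) (by positivity)
  rw [besselDigammaCoeff, besselDigammaCoeff, ← add_assoc j, digammaSucc_succ,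
    digammaSucc_succ]
  push_cast
  have h1 : (k : ℝ) + 1 ≠ 0 := by positivity
  have h2 : (j : ℝ) + k + 1 ≠ 0 := by positivity
  have i1 : ((k : ℝ) + 1) * ((k : ℝ) + 1)⁻¹ = 1 := mul_inv_cancel₀ h1
  have i2 : ((j : ℝ) + k + 1) * ((j : ℝ) + k + 1)⁻¹ = 1 := mul_inv_cancel₀ h2
  linear_combination (digammaSucc k + digammaSucc (j + k)) * h
    + (k + (j + 1)) * besselCoeff j μ (k + 1) * i1 + (k + 1) * besselCoeff j μ (k + 1) * i2

/-- The homogeneous recurrence fails only where the finite sum is truncated, at `k + 1 = j`. This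
defect cancels the pole `m b₀ / s` of the logarithmic term. -/
theorem besselPolarCoeff_succ (j : ℕ) (μ : ℝ) (k : ℕ) :
    (k + 1) * (k + (1 - (j : ℝ))) * besselPolarCoeff j μ (k + 1) + μ * besselPolarCoeff j μ k
      = if k + 1 = j then μ ^ j / (k.factorial : ℝ) else 0 := by
  rcases lt_trichotomy (k + 1) j with h | h | h
  · obtain ⟨i, rfl⟩ := Nat.exists_eq_add_of_lt h
    rw [besselPolarCoeff, besselPolarCoeff, if_pos h, if_pos (by omega), if_neg h.ne]
    have e1 : k + 1 + i + 1 - (k + 1) - 1 = i := by omega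
    have e2 : k + 1 + i + 1 - k - 1 = i + 1 := by omega
    rw [e1, e2, Nat.factorial_succ i, Nat.factorial_succ k, pow_succ]
    push_cast
    field_simp
    ring
  · subst h
    rw [besselPolarCoeff, besselPolarCoeff, if_neg (lt_irrefl _), if_pos (by omega), if_pos rfl]
    have e : k + 1 - k - 1 = 0 := by omega
    rw [e, pow_succ]
    simp
    ring
  · rw [besselPolarCoeff, besselPolarCoeff, if_neg (by omega), if_neg (by omega), if_neg h.ne']
    ring

theorem besselYNat_mul_eq (j : ℕ) (lam r : ℝ) :
    besselYNat j (|lam| * r)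
      = -(((|lam| / 2 * r) ^ j)⁻¹ / Real.pi) * ser (besselPolarCoeff j (lam ^ 2 / 4)) (r ^ 2)
        + 2 / Real.pi * Real.log (|lam| / 2 * r)
          * ((|lam| / 2 * r) ^ j * ser (besselCoeff j (lam ^ 2 / 4)) (r ^ 2))
        - (|lam| / 2 * r) ^ j / Real.pi * ser (besselDigammaCoeff j (lam ^ 2 / 4)) (r ^ 2) := by
  have h1 : |lam| * r / 2 = |lam| / 2 * r := by ring
  have h2 : (|lam| * r) ^ 2 / 4 = lam ^ 2 / 4 * r ^ 2 := by
    rw [mul_pow, sq_abs]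
    ring
  rw [besselYNat, besselJ_mul_eq, h1, h2, Real.rpow_natCast]
  congr 1
  · congr 2
    rw [ser, tsum_eq_sum (s := Finset.range j) fun k hk => by
      rw [besselPolarCoeff, if_neg (by simpa using hk), zero_mul]]
    refine Finset.sum_congr rfl fun k hk => ?_
    rw [besselPolarCoeff, if_pos (by simpa using hk), mul_pow]
    ring
  · congr 1
    refine tsum_congr fun k => ?_
    rw [besselDigammaCoeff, besselCoeff_nat, ← neg_mul, mul_pow]
    ring

theorem besselY_natCast (j : ℕ) (z : ℝ) : besselY j z = besselYNat j z := by
  rw [besselY, if_pos ⟨j, by simp⟩, if_pos (by positivity), Nat.floor_natCast]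

/-- For half-integral order, `Y_ν` is a multiple of `J_{-ν}`, so no logarithm occurs in odd
dimension. -/
theorem besselY_of_cos_eq_zero {ν : ℝ} (h : ¬∃ j : ℤ, ν = j) (hc : Real.cos (ν * Real.pi) = 0)
    (z : ℝ) : besselY ν z = -besselJ (-ν) z / Real.sin (ν * Real.pi) := by
  rw [besselY, if_neg h, hc, mul_zero, zero_sub]

/-! ### The radial function is a radial profile -/

theorem sphereVol_two : sphereVol 2 = 2 * Real.pi := by
  rw [sphereVol_eq, Measure.real, EuclideanSpace.volume_ball_fin_two]
  simp [Real.pi_pos.le]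

/-- The multiple `d` of `J_j` is arbitrary because `J_j` contributes only a regular solution; this
covers the correction terms for `n = 2` and for even `n ≥ 4` together. The value of `κ` is forced by
the flux normalisation. -/
theorem exists_profile_besselY_nat {n j : ℕ} (hn : n = 2 * j + 2) {lam : ℝ} (hlam : lam ≠ 0)
    {κ : ℝ} (hκ : κ = Real.pi * (|lam| / 2) ^ j / (2 * j.factorial * sphereVol n)) (d : ℝ) :
    ∃ F, IsRadialProfile n lam F ∧ ∀ r, 0 < r → -κ * r ^ (-(j : ℝ))
      * (besselY j (|lam| * r) - d * besselJ j (|lam| * r)) = F (r ^ 2) := by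
  have hℓ : 0 < |lam| / 2 := by positivity
  set ℓ := |lam| / 2 with hℓdef
  have hμ : lam ^ 2 / 4 = ℓ ^ 2 := by
    rw [hℓdef, div_pow, sq_abs]
    norm_num
  have hω := sphereVol_pos (n := n) (by omega)
  have hπ := Real.pi_pos
  set p := besselPolarCoeff j (lam ^ 2 / 4) with hp
  set q := besselCoeff j (lam ^ 2 / 4) with hq
  set t := besselDigammaCoeff j (lam ^ 2 / 4) with ht
  have ep : IsEntireCoeff p := isEntireCoeff_besselPolarCoeff j (by positivity)
  have eq : IsEntireCoeff q := isEntireCoeff_besselCoeff_nat j _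
  have et : IsEntireCoeff t := isEntireCoeff_besselDigammaCoeff j _
  have hq0 : q 0 = 1 / (j.factorial : ℝ) := by
    rw [hq, besselCoeff_nat]
    simp
  have hqs := fun k => besselCoeff_succ (ν := j) (μ := lam ^ 2 / 4) (k := k) (by positivity)
  have hts := besselDigammaCoeff_succ j (lam ^ 2 / 4)
  -- Read off from the expansion of `Y_j` with `s = r²`: the finite sum gives `a`; since `2 log (ℓ
  -- r) = 2 log ℓ + log s`, the logarithm splits between `b` and `c`; the term in `d` and the
  -- digamma series go into `c`.
  refine ⟨frobenius j (fun k => κ * (ℓ ^ j)⁻¹ / Real.pi * p k)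
    (fun k => -(κ * ℓ ^ j / Real.pi) * q k)
    (fun k => -(κ * (2 / Real.pi * Real.log ℓ - d) * ℓ ^ j) * q k + κ * ℓ ^ j / Real.pi * t k),
    ?_, fun r hr => ?_⟩
  · refine isRadialProfile_frobenius (by omega) (by rw [hn]; push_cast; ring) (ep.const_mul _)
      (eq.const_mul _) ((eq.const_mul _).add (et.const_mul _)) (fun k => ?_) (fun k => ?_)
      (fun s hs => ?_) ?_
    · linear_combination -(κ * ℓ ^ j / Real.pi) * hqs k
    · linear_combination -(κ * (2 / Real.pi * Real.log ℓ - d) * ℓ ^ j) * hqs k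
        + κ * ℓ ^ j / Real.pi * hts k
    · have e : ∀ k : ℕ, (k + 1) * (k + (1 - (j : ℝ))) * (κ * (ℓ ^ j)⁻¹ / Real.pi * p (k + 1))
          + lam ^ 2 / 4 * (κ * (ℓ ^ j)⁻¹ / Real.pi * p k)
          = κ * (ℓ ^ j)⁻¹ / Real.pi *
            (if k + 1 = j then (lam ^ 2 / 4) ^ j / (k.factorial : ℝ) else 0) := fun k => by
        rw [← besselPolarCoeff_succ]
        ring
      simp only [e]
      rw [ser_const_mul, hq0, Real.rpow_neg hs.le, Real.rpow_natCast]
      cases j with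
      | zero => simp [ser_zero_coeff]
      | succ i =>
        -- Only the truncation defect at `k = j - 1` survives, and it equals `-j b₀ / s`.
        rw [ser, tsum_eq_single i fun k hk => by rw [if_neg (by omega), zero_mul], if_pos rfl,
          hμ, Nat.factorial_succ]
        clear_value ℓ
        push_cast
        field_simp
        ring
    · cases j with
      | zero =>
        simp only [Nat.cast_zero, zero_mul, neg_zero, zero_add, if_true, hq0, hκ]
        simp
        field_simp
      | succ i =>
        have h1 : ((i + 1 : ℕ) : ℝ) ≠ 0 := by positivity
        rw [if_neg h1, add_zero, hp, besselPolarCoeff, if_pos (by omega), hκ, Nat.factorial_succ]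
        simp
        field_simp
  · have hr2 : Real.log (r ^ 2) = 2 * Real.log r := by
      rw [Real.log_pow]
      norm_num
    have hrp : (r ^ 2) ^ (-(j : ℝ)) = (r ^ j)⁻¹ * (r ^ j)⁻¹ := by
      rw [Real.rpow_neg (by positivity), Real.rpow_natCast, ← pow_mul, mul_comm, pow_mul, sq,
        mul_inv]
    rw [besselY_natCast, besselYNat_mul_eq, besselJ_mul_eq, ← hℓdef, frobenius,
      ser_add (eq.const_mul _) (et.const_mul _), ser_const_mul, ser_const_mul, ser_const_mul,
      ser_const_mul, hr2, hrp, Real.log_mul hℓ.ne' hr.ne', Real.rpow_neg hr.le,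
      Real.rpow_natCast, Real.rpow_natCast, mul_pow, ← hp, ← hq, ← ht]
    have hrj : r ^ j ≠ 0 := by positivity
    field_simp
    ring

theorem exists_profile_besselY_half {n j : ℕ} (hj : 0 < j) (hn : n = 2 * j + 1) {m : ℝ}
    (hm : m = ((n : ℝ) - 2) / 2) {lam : ℝ} (hlam : lam ≠ 0) {κ : ℝ}
    (hκ : κ = Real.pi * (|lam| / 2) ^ m / (2 * m * Real.Gamma m * sphereVol n)) :
    ∃ F, IsRadialProfile n lam F ∧ ∀ r, 0 < r → -κ * r ^ (-m) * besselY m (|lam| * r)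
      = F (r ^ 2) := by
  have hℓ : 0 < |lam| / 2 := by positivity
  set ℓ := |lam| / 2 with hℓdef
  have hω := sphereVol_pos (n := n) (by omega)
  have hmj : m = j - 1 / 2 := by
    rw [hm, hn]
    push_cast
    ring
  have hj1 : (1 : ℝ) ≤ j := by exact_mod_cast hj
  have hm0 : 0 < m := by linarith
  have hint : ¬∃ i : ℤ, m = i := by
    rintro ⟨i, hi⟩
    have h : ((2 * j - 1 : ℤ) : ℝ) = ((2 * i : ℤ) : ℝ) := by
      push_cast
      linarith
    have h' : (2 * j - 1 : ℤ) = 2 * i := by exact_mod_cast h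
    omega
  have hcos : Real.cos (m * Real.pi) = 0 := by
    rw [Real.cos_eq_zero_iff]
    refine ⟨j - 1, ?_⟩
    rw [hmj]
    push_cast
    ring
  have hsin : Real.sin (m * Real.pi) ≠ 0 := by
    intro h
    have := Real.sin_sq_add_cos_sq (m * Real.pi)
    rw [h, hcos] at this
    norm_num at this
  have hhalf : ∀ k : ℕ, 1 / 2 ≤ |-m + k + 1| := fun k => by
    rw [hmj, le_abs]
    rcases le_or_gt j (k + 1) with h | h
    · left
      have : (j : ℝ) ≤ k + 1 := by exact_mod_cast h
      linarith
    · right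
      have : (k : ℝ) + 2 ≤ j := by exact_mod_cast h
      linarith
  have hne : ∀ k : ℕ, -m + k + 1 ≠ 0 := fun k h0 => by
    have := hhalf k
    rw [h0, abs_zero] at this
    norm_num at this
  set q := besselCoeff (-m) (lam ^ 2 / 4) with hq
  have eq : IsEntireCoeff q := isEntireCoeff_besselCoeff hhalf
  have hqs := fun k => besselCoeff_succ (μ := lam ^ 2 / 4) (hne k)
  -- Here `-κ r^(-m) Y_m` is `κ r^(-m) J_{-m} / sin (m π)`, a pure `s^(-m)` series.
  refine ⟨frobenius m (fun k => κ * ℓ ^ (-m) / Real.sin (m * Real.pi) * q k) (fun _ => 0)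
    (fun _ => 0), ?_, fun r hr => ?_⟩
  · refine isRadialProfile_frobenius (by omega) hm (eq.const_mul _) isEntireCoeff_zero
      isEntireCoeff_zero (by simp) (by simp) (fun s hs => ?_) ?_
    · have e : ∀ k : ℕ, (k + 1) * (k + (1 - m)) * (κ * ℓ ^ (-m) / Real.sin (m * Real.pi)
          * q (k + 1)) + lam ^ 2 / 4 * (κ * ℓ ^ (-m) / Real.sin (m * Real.pi) * q k) = 0 :=
        fun k => by linear_combination κ * ℓ ^ (-m) / Real.sin (m * Real.pi) * hqs k
      simp only [e, ser_zero_coeff]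
      simp
    -- Euler's reflection formula turns `Γ(m) Γ(1-m) sin (m π)` into `π`, which gives the required
    -- leading coefficient.
    · have hΓ := Real.Gamma_mul_Gamma_one_sub m
      rw [mul_comm Real.pi m] at hΓ
      have hΓ0 := (Real.Gamma_pos_of_pos hm0).ne'
      have hΓ1 : Real.Gamma (1 - m) ≠ 0 := by
        intro h
        rw [h, mul_zero] at hΓ
        exact (div_ne_zero Real.pi_pos.ne' hsin) hΓ.symm
      have hq0 : q 0 = 1 / Real.Gamma (1 - m) := by
        rw [hq, besselCoeff]
        simp [neg_add_eq_sub]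
      have hℓm := (Real.rpow_pos_of_pos hℓ m).ne'
      rw [if_neg hm0.ne', add_zero, hq0, hκ, Real.rpow_neg hℓ.le]
      rw [eq_div_iff hsin] at hΓ
      field_simp
      linear_combination hΓ
  · have hrp : (r ^ 2) ^ (-m) = r ^ (-m) * r ^ (-m) := by
      rw [sq, Real.mul_rpow hr.le hr.le]
    rw [besselY_of_cos_eq_zero hint hcos, besselJ_mul_eq, ← hℓdef, ← hq, frobenius,
      ser_const_mul, ser_zero_coeff, hrp, Real.mul_rpow hℓ.le hr.le]
    ring

theorem exists_profile_radialFun {n : ℕ} (hn : 2 ≤ n) (lam : ℝ) :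
    ∃ F, IsRadialProfile n lam F ∧ ∀ z : E n, z ≠ 0 → radialFun n lam z = F (‖z‖ ^ 2) := by
  have hω := sphereVol_pos (n := n) (by omega)
  by_cases hlam : lam = 0
  · by_cases h2 : n = 2
    · subst h2
      refine ⟨frobenius 0 (fun _ => 0) (fun k => if k = 0 then -(1 / (4 * Real.pi)) else 0)
        (fun _ => 0), ?_, fun z hz => ?_⟩
      · refine isRadialProfile_frobenius le_rfl (by norm_num) isEntireCoeff_zero
          (isEntireCoeff_const _) isEntireCoeff_zero (by simp [hlam]) (by simp [hlam])
          (by simp [ser_zero_coeff]) ?_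
        rw [sphereVol_two]
        simp
        ring
      · rw [radialFun, if_pos hlam, if_pos rfl, frobenius, ser_zero_coeff,
          ser_const_coeff, Real.log_pow]
        push_cast
        ring
    · have hn' : (n : ℝ) - 2 ≠ 0 := by
        rw [sub_ne_zero]
        exact_mod_cast h2
      refine ⟨frobenius (((n : ℝ) - 2) / 2)
        (fun k => if k = 0 then 1 / (((n : ℝ) - 2) * sphereVol n) else 0) (fun _ => 0)
        (fun _ => 0), ?_, fun z hz => ?_⟩
      · refine isRadialProfile_frobenius hn rfl (isEntireCoeff_const _) isEntireCoeff_zero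
          isEntireCoeff_zero (by simp) (by simp) (by simp [hlam, ser_zero_coeff]) ?_
        simp
        field_simp
      · have hz' : 0 < ‖z‖ := norm_pos_iff.2 hz
        rw [radialFun, if_pos hlam, if_neg h2, frobenius, ser_zero_coeff,
          ser_const_coeff, Real.rpow_neg (by positivity)]
        have e : ((n : ℝ) - 2) / 2 = ((n - 2 : ℕ) : ℝ) / 2 := by
          rw [Nat.cast_sub hn]
          norm_num
        rw [e, ← pow_eq_sq_rpow hz']
        field_simp
        ring
  rcases Nat.even_or_odd n with hev | hodd
  · obtain ⟨i, hi⟩ := hev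
    obtain ⟨j, rfl⟩ : ∃ j, i = j + 1 := ⟨i - 1, by omega⟩
    have hnj : n = 2 * j + 2 := by omega
    have hm : ((n : ℝ) - 2) / 2 = j := by
      rw [hnj]
      push_cast
      ring
    cases j with
    | zero =>
      have h2 : n = 2 := by omega
      subst h2
      obtain ⟨F, hF, h⟩ := exists_profile_besselY_nat hnj hlam (κ := 1 / 4)
        (by
          rw [sphereVol_two]
          have := Real.pi_pos
          simp
          field_simp
          norm_num)
        -- With `κ = 1/4`, this is the multiple of `J_0` for which `κ d` is the coefficient of `J_0`
        -- in `f_λ`.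
        (2 / Real.pi * (Real.log |lam| - Real.log 2 + Real.eulerMascheroniConstant))
      refine ⟨F, hF, fun z hz => ?_⟩
      rw [← h _ (norm_pos_iff.2 hz), radialFun, if_neg hlam, if_pos rfl]
      simp
      ring
    | succ i =>
      have h2 : n ≠ 2 := by omega
      obtain ⟨F, hF, h⟩ := exists_profile_besselY_nat hnj hlam rfl
        (2 * (Real.log |lam| - Real.log 2) / Real.pi)
      refine ⟨F, hF, fun z hz => ?_⟩
      rw [← h _ (norm_pos_iff.2 hz), radialFun, if_neg hlam, if_neg h2,
        if_neg (Nat.not_odd_iff_even.2 ⟨i + 1 + 1, hi⟩)]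
      simp only [hm]
      have hΓ : Real.Gamma ((i + 1 : ℕ) : ℝ) = (i.factorial : ℝ) := by
        rw [← Real.Gamma_nat_eq_factorial]
        push_cast
        rfl
      have hn2 : (n : ℝ) - 2 = 2 * ((i : ℝ) + 1) := by
        rw [hnj]
        push_cast
        ring
      rw [hΓ, Real.rpow_natCast, Real.rpow_natCast, hn2, Nat.factorial_succ, div_pow]
      congr 3
      push_cast
      field_simp
  · obtain ⟨j, hj⟩ := hodd
    have h2 : n ≠ 2 := by omega
    have hn3 : (3 : ℝ) ≤ n := by
      have : 3 ≤ n := by omega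
      exact_mod_cast this
    obtain ⟨F, hF, h⟩ := exists_profile_besselY_half (by omega) hj rfl hlam rfl
    refine ⟨F, hF, fun z hz => ?_⟩
    rw [← h _ (norm_pos_iff.2 hz), radialFun, if_neg hlam, if_neg h2, if_pos ⟨j, hj⟩]
    have hΓ := (Real.Gamma_pos_of_pos (s := ((n : ℝ) - 2) / 2) (by linarith)).ne'
    have h2m := (Real.rpow_pos_of_pos two_pos (((n : ℝ) - 2) / 2)).ne'
    rw [Real.div_rpow (abs_nonneg lam) two_pos.le]
    congr 3
    field_simp

end EuclideanDirac

end

/-! ### The Green's function -/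

theorem mainTheorem6 (n : ℕ) (hn : 2 ≤ n) (lam : ℝ)
    {S : Type*} [NormedAddCommGroup S] [InnerProductSpace ℂ S]
    (σ : EuclideanDirac.SpinorModule n S) :
    ∃ G : EuclideanDirac.E n → EuclideanDirac.E n → (S →L[ℂ] S),
      EuclideanDirac.IsGreensFunction σ lam G ∧
      ∀ (γ : S) (x y : EuclideanDirac.E n), x ≠ y →
        G x y γ =
          EuclideanDirac.dirac σ (fun z => EuclideanDirac.radialFun n lam z • γ) (x - y)
            + lam • (EuclideanDirac.radialFun n lam (x - y) • γ) := by
  obtain ⟨F, hF, h⟩ := EuclideanDirac.exists_profile_radialFun hn lam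
  refine ⟨_, hF.isGreensFunction (by omega) σ, fun γ x y hxy => ?_⟩
  have hne : x - y ≠ 0 := sub_ne_zero.2 hxy
  -- The Dirac operator at `x - y ≠ 0` sees only a neighbourhood avoiding the origin, where the
  -- radial function agrees with its profile; its value at `0` is irrelevant.
  have heq : (fun z => EuclideanDirac.radialFun n lam z • γ)
      =ᶠ[nhds (x - y)] fun z => F (‖z‖ ^ 2) • γ := by
    filter_upwards [isOpen_ne.mem_nhds hne] with z hz
    rw [h z hz]
  rw [EuclideanDirac.dirac_congr σ heq, hF.dirac_smul_const σ γ hne, h _ hne, smul_smul,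
    EuclideanDirac.radialKernel_apply]
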